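/- Let $c>1$ be a real constant. For each $n$ let $m=m(n)\in\mathbb N$ and let $\mathbf p^{(n)}=(p_1,\dots,p_m)\in[0,1]^m$ (the $p_i$ depend on $n$). Let $B$ be the random bipartite graph between the vertex set $V=\{1,\dots,n\}$ and $m$ attributes in which the pairs $(v,i)$ are edges independently, $(v,i)$ with probability $p_i$. Let $G$ be the random intersection graph on $V$ in which two distinct vertices are adjacent if and only if they are joined in $B$ to a common attribute. Write $p=p(n)=\max_i p_i$. Suppose that $n\sum_{i=1}^m p_i^2=c$ for all sufficiently large $n$, and that $p=o(n^{-\gamma})$ for some constant $\gamma>1/2$. Then, with high probability (that is, with probability tending to $1$ as $n\to\infty$), $G$ has a unique giant component, it has $\Omega(\min\{p^{-1},n\})$ vertices, and all other components have $O(\max\{np\log n,\log n\})$ vertices. Precisely, there are constants $a,C>0$ depending only on $c$ such that with high probability exactly one component of $G$ has at least $a\min\{p^{-1},n\}$ vertices, and every other component has at most $C\max\{np\log n,\log n\}$ vertices. In particular, if $p^{-1}=o(n)$, then the same holds with $a\min\{p^{-1},n\}$ replaced by $a\,p^{-1}$; and if $n=O(p^{-1})$, then it holds with $a\min\{p^{-1},n\}$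 replaced by $b\,n$ for some constant $b>0$ (which may depend on the implied constant in $n=O(p^{-1})$). -/

import Mathlib

open MeasureTheory ProbabilityTheory Filter Topology Asymptotics unitInterval

noncomputable section

namespace RandomIntersection

/-- A bipartite graph between `n` vertices and `m` attributes, given by its edge indicators. -/
abbrev Bip (n m : ℕ) : Type := Fin n × Fin m → Bool

/-- The law of the random bipartite graph: the edge indicators of the pairs `(v, i)` are
independent, and the one of `(v, i)` is Bernoulli with parameter `p i`. -/
def bipLaw (n : ℕ) {m : ℕ} (p : Fin m → I) : Measure (Bip n m) :=
  Measure.pi fun e : Fin n × Fin m => bernoulliMeasure true false (p e.2)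

instance (n : ℕ) {m : ℕ} (p : Fin m → I) : IsProbabilityMeasure (bipLaw n p) := by
  unfold bipLaw
  infer_instance

/-- The intersection graph: distinct vertices are adjacent iff they share an attribute. -/
def interGraph {n m : ℕ} (B : Bip n m) : SimpleGraph (Fin n) where
  Adj u v := u ≠ v ∧ ∃ i : Fin m, B (u, i) = true ∧ B (v, i) = true
  symm := ⟨fun _ _ h => ⟨h.1.symm, h.2.imp fun _ hi => ⟨hi.2, hi.1⟩⟩⟩
  loopless := ⟨fun _ h => h.1 rfl⟩

/-- The number of vertices of a connected component. -/
def compSize {V : Type*} {G : SimpleGraph V} (K : G.ConnectedComponent) : ℕ :=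
  K.supp.ncard

/-- The largest attribute probability. -/
def maxProb {m : ℕ} (p : Fin m → I) : ℝ := ⨆ i, (p i : ℝ)

/-- `G` has a component with at least `s` vertices, and every other component has fewer than `s`
vertices and at most `t` vertices. -/
def HasUniqueGiant {V : Type*} (G : SimpleGraph V) (s t : ℝ) : Prop :=
  ∃ K : G.ConnectedComponent, s ≤ compSize K ∧
    ∀ K' : G.ConnectedComponent, K' ≠ K → (compSize K' : ℝ) < s ∧ (compSize K' : ℝ) ≤ t

/-- With high probability as `n → ∞`, the intersection graph with parameters `n` and `p n` has the
property `E n`. -/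
def WHP {m : ℕ → ℕ} (p : ∀ n, Fin (m n) → I) (E : ∀ n, SimpleGraph (Fin n) → Prop) : Prop :=
  Tendsto (fun n => bipLaw n (p n) {B | E n (interGraph B)}) atTop (𝓝 1)

end RandomIntersection

end

/-! Put `L = max (n * p) 1`, so that `n / L = min p⁻¹ n`. The graph is explored vertex by vertex,
and an attribute is discarded once one of its members has been explored. While the vertices found
and the weight of the discarded attributes stay below a small multiple of `n / L`, the unused
attributes still carry almost all of `n * ∑ p i ^ 2 = c`, so an explored vertex finds on average
nearly `c > 1` fresh vertices. A single attribute may bring in about `L` vertices at once, hence the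
exponential moments are taken at a rate of order `1 / L` (`integral_exp_low_pop`,
`integral_exp_high_pop`). A deviation by a suitable `Λ` of order `L * log n` then has probability of
order `n⁻²` (`integral_not_good_phase_le`).

Without such a deviation the surplus of active vertices after `j` explorations is at least `(c - 1)
/ 2 * j - Λ`. The active set can therefore run empty only within the first `2 * Λ / (c - 1)`
explorations (`exists_explored_run`), and after order `n / L` explorations it has order `n / L`
vertices, all in one component (`le_card_active_phase`).

For uniqueness, these active vertices are put aside and a second phase is run from each fresh vertex
`v`. Either `v` is caught in a small component, or it reaches order `n / L` new active vertices. The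
incidences of both sets with the unused attributes are still unrevealed, so by the strong Markov
property (`integral_run`) the sets are linked except with probability `exp (-Ω((n / L) ^ 2 / n))`
(`integral_not_linked_le`). A union bound over `v` and the deterministic lemma
`hasUniqueGiant_of_phases` finish the proof. The assumption `γ > 1 / 2` gives `L ^ 2 * log n =
o(n)`, which makes the linking failure negligible and `L * log n` small against `n / L`. -/

namespace RandomIntersection

/-! ### Independence and resampling of edge indicators -/

section Expectation

variable {n m : ℕ} (p : Fin m → I)

lemma integrable_bip (f : Bip n m → ℝ) : Integrable f (bipLaw n p) := .of_finite

/-- Functions of disjoint sets of edge indicators are uncorrelated. -/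
lemma integral_mul_of_dependsOn {f g : Bip n m → ℝ} {S T : Set (Fin n × Fin m)}
    (hf : DependsOn f S) (hg : DependsOn g T) (hST : Disjoint S T) :
    ∫ B, f B * g B ∂bipLaw n p = (∫ B, f B ∂bipLaw n p) * ∫ B, g B ∂bipLaw n p := by
  classical
  obtain ⟨f', rfl⟩ := dependsOn_iff_exists_comp.1
    (hf.mono (by simp : S ⊆ ((S.toFinset : Finset _) : Set (Fin n × Fin m))))
  obtain ⟨g', rfl⟩ := dependsOn_iff_exists_comp.1
    (hg.mono (by simp : T ⊆ ((T.toFinset : Finset _) : Set (Fin n × Fin m))))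
  have hind : iIndepFun (fun (e : Fin n × Fin m) (B : Bip n m) => B e) (bipLaw n p) :=
    iIndepFun_pi (X := fun _ b => b) fun _ => aemeasurable_id
  have h := hind.indepFun_finset S.toFinset T.toFinset (by simpa using hST)
    (fun e => measurable_pi_apply e)
  exact (h.comp (φ := f') (ψ := g') (measurable_of_finite _)
    (measurable_of_finite _)).integral_fun_mul_eq_mul_integral
    (integrable_bip p _).aestronglyMeasurable (integrable_bip p _).aestronglyMeasurable

lemma dependsOn_finset_prod {ι κ : Type*} {α : ι → Type*} (s : Finset κ)
    {f : κ → (∀ i, α i) → ℝ} {R : κ → Set ι} (hf : ∀ k ∈ s, DependsOn (f k) (R k)) :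
    DependsOn (fun x => ∏ k ∈ s, f k x) (⋃ k ∈ s, R k) := fun _ _ hxy =>
  Finset.prod_congr rfl fun k hk => hf k hk fun i hi => hxy i (Set.mem_biUnion hk hi)

lemma integral_prod_of_dependsOn {κ : Type*} (s : Finset κ) {f : κ → Bip n m → ℝ}
    {R : κ → Set (Fin n × Fin m)} (hf : ∀ k ∈ s, DependsOn (f k) (R k))
    (hR : (s : Set κ).PairwiseDisjoint R) :
    ∫ B, ∏ k ∈ s, f k B ∂bipLaw n p = ∏ k ∈ s, ∫ B, f k B ∂bipLaw n p := by
  classical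
  induction s using Finset.induction_on with
  | empty => simp
  | insert a s ha ih =>
    simp_rw [Finset.prod_insert ha]
    rw [integral_mul_of_dependsOn p (hf a (by simp))
      (dependsOn_finset_prod s fun k hk => hf k (by simp [hk])), ih]
    · exact fun k hk => hf k (by simp [hk])
    · exact hR.subset (by simp)
    · rw [Set.disjoint_iUnion₂_right]
      exact fun k hk => hR (by simp) (by simp [hk]) fun h => ha (h ▸ hk)

lemma integral_edge (e : Fin n × Fin m) (φ : Bool → ℝ) :
    ∫ B, φ (B e) ∂bipLaw n p = p e.2 * φ true + (1 - p e.2) * φ false := by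
  have h : Measure.map (fun B : Bip n m => B e) (bipLaw n p) = bernoulliMeasure true false (p e.2) :=
    (measurePreserving_eval (fun e : Fin n × Fin m => bernoulliMeasure true false (p e.2)) e).map_eq
  rw [← integral_map (μ := bipLaw n p) (φ := fun B : Bip n m => B e)
    (measurable_pi_apply e).aemeasurable (measurable_of_finite φ).aestronglyMeasurable, h,
    integral_bernoulliMeasure]
  simp

/-- If the event `T = s` is determined by the edges in `R s`, and `g s` by the other edges, then
the edges not used by `T` may be resampled. -/
lemma integral_resample {τ : Type*} (T : Bip n m → τ) (g : τ → Bip n m → ℝ)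
    (R : τ → Set (Fin n × Fin m)) (hT : ∀ s, DependsOn (fun B => T B = s) (R s))
    (hg : ∀ B, DependsOn (g (T B)) (R (T B))ᶜ) :
    ∫ B, g (T B) B ∂bipLaw n p = ∫ B, ∫ B', g (T B) B' ∂bipLaw n p ∂bipLaw n p := by
  classical
  have key : ∀ h : τ → Bip n m → ℝ, ∀ B, h (T B) B =
      ∑ s ∈ Finset.univ.image T, (if T B = s then 1 else 0) * h s B := by
    intro h B
    simp only [ite_mul, one_mul, zero_mul]
    rw [Finset.sum_ite_eq, if_pos (Finset.mem_image_of_mem _ (Finset.mem_univ _))]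
  simp_rw [key g]
  have key2 := key fun s _ => ∫ B', g s B' ∂bipLaw n p
  rw [integral_finsetSum _ fun _ _ => integrable_bip p _]
  simp_rw [key2]
  rw [integral_finsetSum _ fun _ _ => integrable_bip p _]
  refine Finset.sum_congr rfl fun s hs => ?_
  -- Only attained values of `T` occur in the sum, and `hg` is available exactly for these.
  obtain ⟨B₀, -, rfl⟩ := Finset.mem_image.1 hs
  rw [integral_mul_of_dependsOn p (S := R (T B₀)) (T := (R (T B₀))ᶜ) _ (hg B₀)
    disjoint_compl_right, integral_mul_const]
  intro x y hxy
  have := hT (T B₀) hxy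
  simp only [this]

end Expectation

end RandomIntersection

/-! ### Generating functions for the neighbourhood of one vertex -/

namespace RandomIntersection

/-- Follows from `1 + y + y² / 2 ≤ exp y`, because `(1 + y + y² / 2) * (1 - y + y² / 2) = 1 + y⁴ /
4`. -/
lemma exp_neg_le_quadratic {y : ℝ} (hy : 0 ≤ y) : Real.exp (-y) ≤ 1 - y + y ^ 2 / 2 := by
  have h := Real.quadratic_le_exp_of_nonneg hy
  rw [Real.exp_neg, inv_le_comm₀ (Real.exp_pos y) (by nlinarith [sq_nonneg (y - 1)])]
  refine le_trans ?_ h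
  rw [inv_le_iff_one_le_mul₀ (by nlinarith [sq_nonneg (y - 1)])]
  nlinarith [sq_nonneg (y ^ 2)]

lemma exp_sub_one_le_two_mul {y : ℝ} (h0 : 0 ≤ y) (h1 : y ≤ 1) : Real.exp y - 1 ≤ 2 * y := by
  have := Real.abs_exp_sub_one_le (x := y) (by rwa [abs_of_nonneg h0])
  rw [abs_of_nonneg h0] at this
  exact (le_abs_self _).trans this

section Hits

variable {n m : ℕ} (p : Fin m → I)

/-- The probability that a given vertex has an attribute in `J`. -/
noncomputable def hitProb (J : Finset (Fin m)) : ℝ := 1 - ∏ i ∈ J, (1 - (p i : ℝ))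

lemma one_sub_coe_nonneg (i : Fin m) : 0 ≤ 1 - (p i : ℝ) := sub_nonneg.2 (p i).2.2

lemma prod_one_sub_nonneg (J : Finset (Fin m)) : 0 ≤ ∏ i ∈ J, (1 - (p i : ℝ)) :=
  Finset.prod_nonneg fun i _ => one_sub_coe_nonneg p i

lemma hitProb_le_one (J : Finset (Fin m)) : hitProb p J ≤ 1 := by
  have := prod_one_sub_nonneg p J
  unfold hitProb
  linarith

lemma hitProb_nonneg (J : Finset (Fin m)) : 0 ≤ hitProb p J := by
  have : ∏ i ∈ J, (1 - (p i : ℝ)) ≤ 1 :=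
    Finset.prod_le_one (fun i _ => one_sub_coe_nonneg p i) fun i _ => by linarith [(p i).2.1]
  unfold hitProb
  linarith

lemma hitProb_le_sum (J : Finset (Fin m)) : hitProb p J ≤ ∑ i ∈ J, (p i : ℝ) := by
  classical
  induction J using Finset.induction_on with
  | empty => simp [hitProb]
  | insert a s ha ih =>
    have h0 := prod_one_sub_nonneg p s
    unfold hitProb at *
    rw [Finset.prod_insert ha, Finset.sum_insert ha]
    have h1 : ∏ i ∈ s, (1 - (p i : ℝ)) ≤ 1 :=
      Finset.prod_le_one (fun i _ => one_sub_coe_nonneg p i) fun i _ => by linarith [(p i).2.1]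
    nlinarith [(p a).2.1]

lemma le_hitProb (J : Finset (Fin m)) :
    ∑ i ∈ J, (p i : ℝ) - (∑ i ∈ J, (p i : ℝ)) ^ 2 / 2 ≤ hitProb p J := by
  have h0 : 0 ≤ ∑ i ∈ J, (p i : ℝ) := Finset.sum_nonneg fun i _ => (p i).2.1
  have h1 : ∏ i ∈ J, (1 - (p i : ℝ)) ≤ Real.exp (-∑ i ∈ J, (p i : ℝ)) := by
    rw [← Finset.sum_neg_distrib, Real.exp_sum]
    exact Finset.prod_le_prod (fun i _ => one_sub_coe_nonneg p i) fun i _ => by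
      linarith [Real.add_one_le_exp (-(p i : ℝ))]
  have := exp_neg_le_quadratic h0
  unfold hitProb
  linarith

lemma ite_exists_eq_prod (B : Bip n m) (w : Fin n) (J : Finset (Fin m)) (a b : ℝ) :
    (if ∃ i ∈ J, B (w, i) = true then a else b) =
      a + (b - a) * ∏ i ∈ J, (if B (w, i) = true then 0 else 1 : ℝ) := by
  split_ifs with h
  · obtain ⟨i, hi, h⟩ := h
    rw [Finset.prod_eq_zero hi (by simp [h])]
    ring
  · push Not at h
    rw [Finset.prod_eq_one fun i hi => by simp [h i hi]]
    ring

lemma dependsOn_edge {β : Type*} (e : Fin n × Fin m) (φ : Bool → β) :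
    DependsOn (fun B : Bip n m => φ (B e)) {e} := fun x y h => by
  simp only [h e rfl]

lemma integral_hit (w : Fin n) (J : Finset (Fin m)) (a b : ℝ) :
    ∫ B, (if ∃ i ∈ J, B (w, i) = true then a else b) ∂bipLaw n p = b + (a - b) * hitProb p J := by
  simp_rw [ite_exists_eq_prod]
  rw [integral_add (integrable_bip p _) (integrable_bip p _), integral_const_mul,
    integral_prod_of_dependsOn p J (R := fun i => {(w, i)})
      (fun i _ => dependsOn_edge (w, i) fun b => if b = true then (0 : ℝ) else 1)]
  · have : ∀ i, ∫ B, (if B (w, i) = true then 0 else 1 : ℝ) ∂bipLaw n p = 1 - p i := fun i => by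
      rw [integral_edge p (w, i) fun b => if b = true then (0 : ℝ) else 1]
      simp
    simp only [this, integral_const, probReal_univ, hitProb, smul_eq_mul]
    ring
  · intro i _ j _ hij
    simpa using hij

lemma pow_card_filter {α : Type*} (W : Finset α) (P : α → Prop) [DecidablePred P] (z : ℝ) :
    z ^ (W.filter P).card = ∏ w ∈ W, if P w then z else 1 := by
  simp [Finset.prod_ite]

/-- The vertices of `W` hit `J` independently, so the count is binomial and this is its generating
function. -/
lemma integral_pow_hits (W : Finset (Fin n)) (J : Finset (Fin m)) (z : ℝ) :
    ∫ B, z ^ (W.filter fun w => ∃ i ∈ J, B (w, i) = true).card ∂bipLaw n p =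
      (1 + (z - 1) * hitProb p J) ^ W.card := by
  simp_rw [pow_card_filter]
  rw [integral_prod_of_dependsOn p W (R := fun w => {e | e.1 = w})]
  · simp [integral_hit]
  · intro w _ B B' h
    have : ∀ i, B (w, i) = B' (w, i) := fun i => h _ rfl
    simp only [this]
  · intro i _ j _ hij
    refine Set.disjoint_left.2 fun e he he' => hij ?_
    exact he.symm.trans he'

/-- The vertices of `W` sharing with `x` an attribute in `F` are explored in two rounds: first the
attributes of `x`, then the remaining vertices. -/
lemma integral_pow_neighbours {x : Fin n} {W : Finset (Fin n)} (hx : x ∉ W) (F : Finset (Fin m))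
    (z : ℝ) (φ : Finset (Fin m) → ℝ) :
    ∫ B, z ^ (W.filter fun w => ∃ i ∈ F, B (x, i) = true ∧ B (w, i) = true).card *
        φ (F.filter fun i => B (x, i) = true) ∂bipLaw n p =
      ∫ B, (1 + (z - 1) * hitProb p (F.filter fun i => B (x, i) = true)) ^ W.card *
        φ (F.filter fun i => B (x, i) = true) ∂bipLaw n p := by
  have h := integral_resample p (fun B : Bip n m => F.filter fun i => B (x, i) = true)
    (fun J B => z ^ (W.filter fun w => ∃ i ∈ J, B (w, i) = true).card * φ J)
    (fun _ => {e | e.1 = x}) ?_ ?_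
  · simp_rw [integral_mul_const, integral_pow_hits] at h
    rw [← h]
    simp [and_assoc]
  · intro s B B' h
    have : ∀ i, B (x, i) = B' (x, i) := fun i => h _ rfl
    simp only [this]
  · intro B₀ B B' h
    have : ∀ w ∈ W, ∀ i, B (w, i) = B' (w, i) := fun w hw i =>
      h _ fun h' : w = x => hx (h' ▸ hw)
    dsimp only
    congr 3
    refine Finset.filter_congr fun w hw => ?_
    simp only [this w hw]

lemma integral_exp_row (x : Fin n) (F : Finset (Fin m)) (a : Fin m → ℝ) :
    ∫ B, Real.exp (∑ i ∈ F.filter (fun i => B (x, i) = true), a i) ∂bipLaw n p =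
      ∏ i ∈ F, (1 + p i * (Real.exp (a i) - 1)) := by
  have : ∀ B : Bip n m, Real.exp (∑ i ∈ F.filter (fun i => B (x, i) = true), a i) =
      ∏ i ∈ F, if B (x, i) = true then Real.exp (a i) else 1 := fun B => by
    rw [Real.exp_sum, Finset.prod_filter]
  simp_rw [this]
  rw [integral_prod_of_dependsOn p F (R := fun i => {(x, i)})
      (fun i _ => dependsOn_edge (x, i) fun b => if b = true then Real.exp (a i) else 1)]
  · refine Finset.prod_congr rfl fun i _ => ?_
    rw [integral_edge p (x, i) fun b => if b = true then Real.exp (a i) else 1]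
    simp
    ring
  · intro i _ j _ hij
    simpa using hij

lemma integral_sum_row (x : Fin n) (F : Finset (Fin m)) (a : Fin m → ℝ) :
    ∫ B, ∑ i ∈ F.filter (fun i => B (x, i) = true), a i ∂bipLaw n p = ∑ i ∈ F, p i * a i := by
  simp_rw [Finset.sum_filter]
  rw [integral_finsetSum _ fun _ _ => integrable_bip p _]
  refine Finset.sum_congr rfl fun i _ => ?_
  rw [integral_edge p (x, i) fun b => if b = true then a i else 0]
  simp

/-- Off-diagonal terms factorise into the squared mean; the diagonal ones produce the cubes. -/
lemma integral_sum_row_sq (x : Fin n) (F : Finset (Fin m)) :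
    ∫ B, (∑ i ∈ F.filter (fun i => B (x, i) = true), (p i : ℝ)) ^ 2 ∂bipLaw n p ≤
      (∑ i ∈ F, (p i : ℝ) ^ 2) ^ 2 + ∑ i ∈ F, (p i : ℝ) ^ 3 := by
  simp_rw [Finset.sum_filter, sq, Finset.sum_mul_sum]
  rw [integral_finsetSum _ fun _ _ => integrable_bip p _, ← Finset.sum_add_distrib]
  refine Finset.sum_le_sum fun i hi => ?_
  rw [integral_finsetSum _ fun _ _ => integrable_bip p _]
  classical
  have key : ∀ j ∈ F, ∫ B, (if B (x, i) = true then (p i : ℝ) else 0) *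
      (if B (x, j) = true then (p j : ℝ) else 0) ∂bipLaw n p ≤
      (p i : ℝ) * p i * (p j * p j) + if j = i then (p i : ℝ) ^ 3 else 0 := by
    intro j _
    have h0 := (p i).2.1
    split_ifs with hij
    · subst hij
      have : ∀ B : Bip n m, (if B (x, j) = true then (p j : ℝ) else 0) *
          (if B (x, j) = true then (p j : ℝ) else 0) =
          (fun b => if b = true then (p j : ℝ) ^ 2 else 0) (B (x, j)) := fun B => by
        dsimp only
        split_ifs <;> ring
      simp_rw [this]
      rw [integral_edge p (x, j) fun b => if b = true then (p j : ℝ) ^ 2 else 0]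
      simp only [if_true, Bool.false_eq_true, if_false]
      have : (0 : ℝ) ≤ p j * p j * (p j * p j) := by positivity
      linarith [pow_succ' (p j : ℝ) 2]
    · rw [integral_mul_of_dependsOn p
        (dependsOn_edge (x, i) fun b => if b = true then (p i : ℝ) else 0)
        (dependsOn_edge (x, j) fun b => if b = true then (p j : ℝ) else 0)
        (by simpa using fun h => hij h.symm),
        integral_edge p (x, i) fun b => if b = true then (p i : ℝ) else 0,
        integral_edge p (x, j) fun b => if b = true then (p j : ℝ) else 0]
      simp
  refine (Finset.sum_le_sum key).trans ?_
  rw [Finset.sum_add_distrib, Finset.sum_ite_eq' F i, if_pos hi]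

end Hits

end RandomIntersection

/-! ### Exponential bounds for one exploration step and for linking two sets -/

namespace RandomIntersection

section OneStep

variable {n m : ℕ} (p : Fin m → I)

/-- Given the attributes of `x`, of total weight `s`, the count is binomial with some success
probability `q`, and its transform is at most `exp (-N q)`. This is expanded to second order: `q ≥ s
- s² / 2` costs `N / 2 * s²`, the exponential costs `N² / 2 * s²`. Finally `s` has mean `s₂`, and
its second moment is at most `s₂² + s₃`. -/
lemma integral_exp_neg_neighbours_le {x : Fin n} {W : Finset (Fin n)} (hx : x ∉ W)
    (F : Finset (Fin m)) {lam : ℝ} (hlam : 0 ≤ lam) {N s₂ s₃ : ℝ}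
    (hN : N = (1 - Real.exp (-lam)) * W.card) (h₂ : s₂ = ∑ i ∈ F, (p i : ℝ) ^ 2)
    (h₃ : s₃ = ∑ i ∈ F, (p i : ℝ) ^ 3) :
    ∫ B, Real.exp (-lam) ^
        (W.filter fun w => ∃ i ∈ F, B (x, i) = true ∧ B (w, i) = true).card ∂bipLaw n p ≤
      1 - N * s₂ + (N + N ^ 2) / 2 * (s₂ ^ 2 + s₃) := by
  have hz : Real.exp (-lam) ≤ 1 := Real.exp_le_one_iff.2 (by linarith)
  have hN0 : 0 ≤ N := hN ▸ mul_nonneg (by linarith) (Nat.cast_nonneg _)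
  have h := integral_pow_neighbours p hx F (Real.exp (-lam)) fun _ => 1
  simp only [mul_one] at h
  rw [h]
  set s : Bip n m → ℝ := fun B => ∑ i ∈ F.filter (fun i => B (x, i) = true), (p i : ℝ) with hs
  have hpt : ∀ B : Bip n m,
      (1 + (Real.exp (-lam) - 1) * hitProb p (F.filter fun i => B (x, i) = true)) ^ W.card ≤
        1 - N * s B + (N + N ^ 2) / 2 * (s B) ^ 2 := by
    intro B
    set q := hitProb p (F.filter fun i => B (x, i) = true) with hq
    have q0 : 0 ≤ q := hitProb_nonneg _ _
    have q1 : q ≤ 1 := hitProb_le_one _ _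
    have qs : q ≤ s B := hitProb_le_sum _ _
    have sq' : s B - s B ^ 2 / 2 ≤ q := le_hitProb _ _
    have h1 : (1 + (Real.exp (-lam) - 1) * q) ^ W.card ≤ Real.exp (-(N * q)) := by
      have : Real.exp (-(N * q)) = Real.exp ((Real.exp (-lam) - 1) * q) ^ W.card := by
        rw [← Real.exp_nat_mul, hN]
        ring_nf
      rw [this]
      refine pow_le_pow_left₀ ?_ (by linarith [Real.add_one_le_exp ((Real.exp (-lam) - 1) * q)]) _
      nlinarith [Real.exp_pos (-lam)]
    have h2 := exp_neg_le_quadratic (mul_nonneg hN0 q0)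
    have h3 : q ^ 2 ≤ s B ^ 2 := pow_le_pow_left₀ q0 qs 2
    have h4 : N ^ 2 * q ^ 2 ≤ N ^ 2 * s B ^ 2 := mul_le_mul_of_nonneg_left h3 (sq_nonneg N)
    have h5 : N * (s B - s B ^ 2 / 2) ≤ N * q := mul_le_mul_of_nonneg_left sq' hN0
    nlinarith
  refine (integral_mono (integrable_bip p _) (integrable_bip p _) hpt).trans ?_
  rw [integral_add (integrable_bip p _) (integrable_bip p _),
    integral_sub (integrable_bip p _) (integrable_bip p _), integral_const_mul,
    integral_const_mul, integral_sum_row]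
  simp only [integral_const, probReal_univ, smul_eq_mul, mul_one]
  have hsq := integral_sum_row_sq p x F
  rw [← h₂, ← h₃] at hsq
  have h2' : ∑ i ∈ F, (p i : ℝ) * p i = s₂ := by
    rw [h₂]
    exact Finset.sum_congr rfl fun _ _ => by ring
  rw [h2']
  have : 0 ≤ (N + N ^ 2) / 2 := by positivity
  linarith [mul_le_mul_of_nonneg_left hsq this]

/-- Exponential lower tail for the number of new vertices found in one step. -/
lemma integral_exp_neg_neighbours_le_exp {x : Fin n} {W : Finset (Fin n)} (hx : x ∉ W)
    (F : Finset (Fin m)) {c L ε ε₀ lam : ℝ} (hc : 1 < c) (hε : ε = (c - 1) / (8 * c))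
    (hε₀ : ε₀ = ε / (c + 1)) (hlam : lam = ε₀ / L) (hL : 1 ≤ L) (hn : 0 < (n : ℝ))
    (hLn : L / n ≤ ε₀) (hp : ∀ i, n * (p i : ℝ) ≤ L) (hW : (1 - ε) * n ≤ W.card)
    (hF₁ : (1 - ε) * c ≤ n * ∑ i ∈ F, (p i : ℝ) ^ 2) (hF₂ : n * ∑ i ∈ F, (p i : ℝ) ^ 2 ≤ c) :
    ∫ B, Real.exp (-lam) ^
        (W.filter fun w => ∃ i ∈ F, B (x, i) = true ∧ B (w, i) = true).card ∂bipLaw n p ≤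
      Real.exp (-lam * (1 + (c - 1) / 2)) := by
  have hWn : (W.card : ℝ) ≤ n := by exact_mod_cast W.card_le_univ.trans (by simp)
  have ε_pos : 0 < ε := by rw [hε]; apply div_pos <;> linarith
  have hεc : ε * (8 * c) = c - 1 := by rw [hε]; field_simp
  have ε_lt : ε < 1 / 8 := by nlinarith
  have hε₀c : ε₀ * (c + 1) = ε := by rw [hε₀]; field_simp
  have ε₀_pos : 0 < ε₀ := by rw [hε₀]; positivity
  have hL0 : 0 < L := by linarith
  have lam_pos : 0 < lam := by rw [hlam]; positivity
  have hlamL : lam * L = ε₀ := by rw [hlam]; field_simp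
  have lam_le : lam ≤ ε := by nlinarith
  set s₂ := ∑ i ∈ F, (p i : ℝ) ^ 2 with h₂
  set s₃ := ∑ i ∈ F, (p i : ℝ) ^ 3 with h₃
  set N := (1 - Real.exp (-lam)) * W.card with hN
  refine (integral_exp_neg_neighbours_le p hx F lam_pos.le hN h₂ h₃).trans ?_
  have hs₂ : 0 ≤ s₂ := Finset.sum_nonneg fun i _ => sq_nonneg _
  have hs₃ : n * s₃ ≤ L * s₂ := by
    rw [h₂, h₃, Finset.mul_sum, Finset.mul_sum]
    refine Finset.sum_le_sum fun i _ => ?_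
    nlinarith [mul_le_mul_of_nonneg_right (hp i) (sq_nonneg (p i : ℝ))]
  have hκ₁ : 1 - Real.exp (-lam) ≤ lam := by linarith [Real.add_one_le_exp (-lam)]
  have hκ₂ : lam * (1 - ε) ≤ 1 - Real.exp (-lam) := by
    nlinarith [exp_neg_le_quadratic lam_pos.le]
  have hN_le : N ≤ lam * n := by
    rw [hN]
    exact mul_le_mul hκ₁ hWn (Nat.cast_nonneg _) lam_pos.le
  have hN_ge : lam * (1 - ε) * ((1 - ε) * n) ≤ N := by
    rw [hN]
    have : 0 ≤ 1 - ε := by linarith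
    exact mul_le_mul hκ₂ hW (by positivity) (by linarith [mul_nonneg lam_pos.le this])
  have hN0 : 0 ≤ N := by
    refine le_trans ?_ hN_ge
    have : 0 ≤ 1 - ε := by linarith
    positivity
  -- the quadratic correction is at most `ε * N * s₂`
  have hquad : (N + N ^ 2) / 2 * (s₂ ^ 2 + s₃) ≤ ε * (N * s₂) := by
    have h1 : n * (s₂ ^ 2 + s₃) ≤ s₂ * (L * (c + 1)) := by
      have h4 := mul_le_mul_of_nonneg_right hF₂ hs₂
      have h5 : 0 ≤ (L - 1) * (c * s₂) := mul_nonneg (by linarith) (by positivity)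
      linarith
    have h2 : s₂ ^ 2 + s₃ ≤ s₂ * (L * (c + 1)) / n := by
      rw [le_div_iff₀ hn]; linarith
    have h3 : (1 + N) * (L / n) ≤ 2 * ε₀ := by
      have : N * (L / n) ≤ ε₀ := by
        calc N * (L / n) ≤ lam * n * (L / n) := by gcongr
          _ = ε₀ := by rw [← hlamL]; field_simp
      linarith
    calc (N + N ^ 2) / 2 * (s₂ ^ 2 + s₃) ≤ (N + N ^ 2) / 2 * (s₂ * (L * (c + 1)) / n) := by gcongr
      _ = N * s₂ * (c + 1) / 2 * ((1 + N) * (L / n)) := by ring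
      _ ≤ N * s₂ * (c + 1) / 2 * (2 * ε₀) := by gcongr
      _ = ε * (N * s₂) := by rw [← hε₀c]; ring
  -- Four factors `1 - ε` are lost: in `1 - exp (-lam)`, in the size of `W`, in the weight of `F`,
  -- and in the quadratic correction. The choice of `ε` makes `c * (1 - 4 * ε)` equal to `1 + (c -
  -- 1) / 2`.
  have hmain : lam * (1 + (c - 1) / 2) ≤ (1 - ε) * (N * s₂) := by
    have h1 : 0 < 1 - ε := by linarith
    have h2 : lam * (1 - ε) * (1 - ε) * ((1 - ε) * c) ≤ N * s₂ := by
      calc lam * (1 - ε) * (1 - ε) * ((1 - ε) * c) ≤ lam * (1 - ε) * (1 - ε) * (n * s₂) := by gcongr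
        _ = lam * (1 - ε) * ((1 - ε) * n) * s₂ := by ring
        _ ≤ N * s₂ := by gcongr
    have h3 : 1 - 4 * ε ≤ (1 - ε) ^ 4 := by
      have := one_add_mul_le_pow (a := -ε) (by linarith) 4
      norm_num at this
      linarith [this, show (1 + -ε) ^ 4 = (1 - ε) ^ 4 by ring]
    calc lam * (1 + (c - 1) / 2) = lam * c * (1 - 4 * ε) := by
          linear_combination (lam / 2) * hεc
      _ ≤ lam * c * (1 - ε) ^ 4 := by gcongr
      _ = (1 - ε) * (lam * (1 - ε) * (1 - ε) * ((1 - ε) * c)) := by ring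
      _ ≤ _ := by gcongr
  have := Real.add_one_le_exp (-lam * (1 + (c - 1) / 2))
  linarith

/-- Exponential upper tail for the number of new vertices and the weight of the attributes used in
one step. -/
lemma integral_exp_neighbours_le_exp {x : Fin n} {W : Finset (Fin n)} (hx : x ∉ W)
    (F : Finset (Fin m)) {c lam : ℝ} (hlam₀ : 0 ≤ lam) (hlam₁ : lam ≤ 1)
    (hp : ∀ i, 3 * lam * n * (p i : ℝ) ≤ 1) (hF : n * ∑ i ∈ F, (p i : ℝ) ^ 2 ≤ c) :
    ∫ B, Real.exp lam ^
        (W.filter fun w => ∃ i ∈ F, B (x, i) = true ∧ B (w, i) = true).card *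
        Real.exp (lam * n * ∑ i ∈ F.filter (fun i => B (x, i) = true), (p i : ℝ)) ∂bipLaw n p ≤
      Real.exp (6 * lam * c) := by
  have hWn : (W.card : ℝ) ≤ n := by exact_mod_cast W.card_le_univ.trans (by simp)
  rw [integral_pow_neighbours p hx F (Real.exp lam)
    fun J => Real.exp (lam * n * ∑ i ∈ J, (p i : ℝ))]
  -- The `3` is `2 + 1`: the vertices found contribute `2 * lam` through `exp lam - 1 ≤ 2 * lam`,
  -- the attribute weight contributes `lam`. The same inequality, applied to `3 * lam * n * p i ≤
  -- 1`, later doubles it to `6`.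
  have hpt : ∀ B : Bip n m,
      (1 + (Real.exp lam - 1) * hitProb p (F.filter fun i => B (x, i) = true)) ^ W.card *
        Real.exp (lam * n * ∑ i ∈ F.filter (fun i => B (x, i) = true), (p i : ℝ)) ≤
      Real.exp (∑ i ∈ F.filter (fun i => B (x, i) = true), 3 * lam * n * (p i : ℝ)) := by
    intro B
    set J := F.filter fun i => B (x, i) = true
    have q0 : 0 ≤ hitProb p J := hitProb_nonneg _ _
    have qs := hitProb_le_sum p J
    have hs : 0 ≤ ∑ i ∈ J, (p i : ℝ) := q0.trans qs
    have he := exp_sub_one_le_two_mul hlam₀ hlam₁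
    have he0 : 0 ≤ Real.exp lam - 1 := by linarith [Real.one_le_exp hlam₀]
    have h1 : (Real.exp lam - 1) * hitProb p J ≤ 2 * lam * ∑ i ∈ J, (p i : ℝ) :=
      mul_le_mul he qs q0 (by linarith)
    have h2 : (1 + (Real.exp lam - 1) * hitProb p J) ^ W.card ≤
        Real.exp (2 * lam * n * ∑ i ∈ J, (p i : ℝ)) := by
      calc (1 + (Real.exp lam - 1) * hitProb p J) ^ W.card
          ≤ Real.exp (2 * lam * ∑ i ∈ J, (p i : ℝ)) ^ W.card := by
            refine pow_le_pow_left₀ (by positivity) ?_ _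
            linarith [Real.add_one_le_exp (2 * lam * ∑ i ∈ J, (p i : ℝ))]
        _ = Real.exp (W.card * (2 * lam * ∑ i ∈ J, (p i : ℝ))) := by rw [← Real.exp_nat_mul]
        _ ≤ _ := by
            rw [Real.exp_le_exp]
            have : 0 ≤ 2 * lam * ∑ i ∈ J, (p i : ℝ) := by positivity
            nlinarith
    calc _ ≤ Real.exp (2 * lam * n * ∑ i ∈ J, (p i : ℝ)) *
          Real.exp (lam * n * ∑ i ∈ J, (p i : ℝ)) := by gcongr
      _ = _ := by
        rw [← Real.exp_add, ← Finset.mul_sum]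
        ring_nf
  refine (integral_mono (integrable_bip p _) (integrable_bip p _) hpt).trans ?_
  rw [integral_exp_row]
  calc ∏ i ∈ F, (1 + (p i : ℝ) * (Real.exp (3 * lam * n * p i) - 1))
      ≤ ∏ i ∈ F, Real.exp (6 * lam * n * (p i : ℝ) ^ 2) := by
        refine Finset.prod_le_prod (fun i _ => ?_) fun i _ => ?_ <;>
        have h0 := (p i).2.1 <;>
        have h1 : 0 ≤ 3 * lam * n * (p i : ℝ) := by positivity
        · have := Real.one_le_exp h1
          have : 0 ≤ (p i : ℝ) * (Real.exp (3 * lam * n * p i) - 1) :=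
            mul_nonneg h0 (by linarith)
          linarith
        · have h2 := mul_le_mul_of_nonneg_left (exp_sub_one_le_two_mul h1 (hp i)) h0
          have := Real.add_one_le_exp (6 * lam * n * (p i : ℝ) ^ 2)
          nlinarith
    _ = Real.exp (6 * lam * (n * ∑ i ∈ F, (p i : ℝ) ^ 2)) := by
        rw [← Real.exp_sum, ← Finset.mul_sum]
        ring_nf
    _ ≤ _ := by
        rw [Real.exp_le_exp]
        exact mul_le_mul_of_nonneg_left hF (by positivity)

/-- The probability that no attribute in `F` links two given disjoint sets of vertices. -/
lemma integral_not_linked_le {A A' : Finset (Fin n)} (hA : Disjoint A A') (F : Finset (Fin m))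
    {t : ℝ} (ht : t ≤ A.card) (ht' : t ≤ A'.card) (hp : ∀ i, t * (p i : ℝ) ≤ 1) (ht0 : 0 ≤ t) :
    ∫ B : Bip n m, (if ∃ i ∈ F, (∃ v ∈ A, B (v, i) = true) ∧ ∃ v ∈ A', B (v, i) = true
        then 0 else 1) ∂bipLaw n p ≤
      Real.exp (-(t ^ 2 / 4 * ∑ i ∈ F, (p i : ℝ) ^ 2)) := by
  classical
  let h : Finset (Fin n) → Fin m → Bip n m → ℝ :=
    fun D i B => ∏ v ∈ D, if B (v, i) = true then 0 else 1
  have hh : ∀ D i B, h D i B = if ∃ v ∈ D, B (v, i) = true then 0 else 1 := by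
    intro D i B
    split_ifs with hD
    · obtain ⟨v, hv, hB⟩ := hD
      exact Finset.prod_eq_zero hv (by simp [hB])
    · push Not at hD
      exact Finset.prod_eq_one fun v hv => by simp [hD v hv]
  have hdep : ∀ D i, DependsOn (h D i) {e | e.1 ∈ D ∧ e.2 = i} := by
    intro D i B B' hB
    refine Finset.prod_congr rfl fun v hv => ?_
    rw [hB (v, i) ⟨hv, rfl⟩]
  have hint : ∀ (D : Finset (Fin n)) (i : Fin m), t ≤ D.card →
      ∫ B, (1 - h D i B) ∂bipLaw n p ≥ t * p i / 2 := by
    intro D i hD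
    have h0 := (p i).2.1
    rw [integral_sub (integrable_bip p _) (integrable_bip p _),
      integral_prod_of_dependsOn p D (R := fun v => {(v, i)})
        (fun v _ => dependsOn_edge (v, i) fun b => if b = true then (0 : ℝ) else 1)
        (fun v _ w _ hvw => by simpa using hvw)]
    have : ∀ v, ∫ B, (if B (v, i) = true then 0 else 1 : ℝ) ∂bipLaw n p = 1 - p i := fun v => by
      rw [integral_edge p (v, i) fun b => if b = true then (0 : ℝ) else 1]
      simp
    simp only [this, integral_const, probReal_univ, Finset.prod_const, smul_eq_mul, mul_one]
    have h1 : (1 - (p i : ℝ)) ^ D.card ≤ Real.exp (-(t * p i)) := by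
      calc (1 - (p i : ℝ)) ^ D.card ≤ Real.exp (-(p i : ℝ)) ^ D.card :=
            pow_le_pow_left₀ (one_sub_coe_nonneg p i)
              (by linarith [Real.add_one_le_exp (-(p i : ℝ))]) _
        _ = Real.exp (D.card * (-(p i : ℝ))) := by rw [← Real.exp_nat_mul]
        _ ≤ _ := by
            rw [Real.exp_le_exp]
            nlinarith
    -- Since `t * p i ≤ 1`, the quadratic term takes away at most half of the linear one.
    have h2 := exp_neg_le_quadratic (mul_nonneg ht0 h0)
    nlinarith [hp i, mul_nonneg ht0 h0]
  have hpt : ∀ B : Bip n m,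
      (if ∃ i ∈ F, (∃ v ∈ A, B (v, i) = true) ∧ ∃ v ∈ A', B (v, i) = true then 0 else 1 : ℝ) =
        ∏ i ∈ F, (1 - (1 - h A i B) * (1 - h A' i B)) := by
    intro B
    simp only [hh]
    split_ifs with hex
    · obtain ⟨i, hi, h1, h2⟩ := hex
      exact (Finset.prod_eq_zero hi (by rw [if_pos h1, if_pos h2]; ring)).symm
    · refine (Finset.prod_eq_one fun i hi => ?_).symm
      by_cases h1 : ∃ v ∈ A, B (v, i) = true
      · have h2 : ¬ ∃ v ∈ A', B (v, i) = true := fun h2 => hex ⟨i, hi, h1, h2⟩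
        rw [if_neg h2]
        ring
      · rw [if_neg h1]
        ring
  have hdep' : ∀ D i, DependsOn (fun B => 1 - h D i B) {e | e.1 ∈ D ∧ e.2 = i} :=
    fun D i B B' hB => by simp only [hdep D i hB]
  simp_rw [hpt]
  rw [integral_prod_of_dependsOn p F (R := fun i => {e | e.2 = i})]
  · rw [Finset.mul_sum, ← Finset.sum_neg_distrib, Real.exp_sum]
    refine Finset.prod_le_prod (fun i _ => ?_) fun i _ => ?_
    · refine integral_nonneg fun B => ?_
      simp only [hh, Pi.zero_apply]
      split_ifs <;> norm_num
    · rw [integral_sub (integrable_bip p _) (integrable_bip p _),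
        integral_mul_of_dependsOn p (hdep' A i) (hdep' A' i)]
      · simp only [integral_const, probReal_univ, smul_eq_mul, mul_one]
        have h0 : 0 ≤ t * p i / 2 := by
          have := (p i).2.1
          positivity
        have := mul_le_mul (hint A i ht) (hint A' i ht') h0 (h0.trans (hint A i ht))
        have := Real.add_one_le_exp (-(t ^ 2 / 4 * (p i : ℝ) ^ 2))
        nlinarith
      · refine Set.disjoint_left.2 fun e he he' => ?_
        exact Finset.disjoint_left.1 hA he.1 he'.1
  · intro i _ B B' hB
    have h1 : ∀ D, h D i B = h D i B' := fun D => hdep D i fun e he => hB e he.2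
    simp only [h1]
  · intro i _ j _ hij
    refine Set.disjoint_left.2 fun e he he' => hij ?_
    exact he.symm.trans he'

end OneStep

end RandomIntersection

/-! ### The exploration process and its Markov property -/

namespace RandomIntersection

/-- The status of a vertex during the exploration of the graph. -/
inductive Mark
  | fresh | active | done | aside
  deriving DecidableEq

/-- A state of the exploration: the status of every vertex, and the set of attributes of which no
member has been explored yet. -/
structure State (n m : ℕ) where
  mark : Fin n → Mark
  attrs : Finset (Fin m)

namespace State

variable {n m : ℕ}

/-- The vertices with a given status. -/
def verts (s : State n m) (k : Mark) : Finset (Fin n) := Finset.univ.filter fun v => s.mark v = k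

@[simp] lemma mem_verts {s : State n m} {k : Mark} {v : Fin n} : v ∈ s.verts k ↔ s.mark v = k := by
  simp [verts]

open Classical in
/-- The next vertex to be explored: an active one if possible, and else a fresh one. -/
noncomputable def next (s : State n m) : Option (Fin n) :=
  if h : ∃ v, s.mark v = .active then some h.choose
  else if h : ∃ v, s.mark v = .fresh then some h.choose else none

lemma next_eq_some {s : State n m} {x : Fin n} (h : s.next = some x) :
    s.mark x = .active ∨ s.mark x = .fresh ∧ ∀ v, s.mark v ≠ .active := by
  unfold next at h
  split_ifs at h with h1 h2
  · obtain rfl := Option.some.inj h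
    exact Or.inl h1.choose_spec
  · obtain rfl := Option.some.inj h
    exact Or.inr ⟨h2.choose_spec, fun v hv => h1 ⟨v, hv⟩⟩

lemma next_eq_none {s : State n m} (h : s.next = none) (v : Fin n) : s.mark v ≠ .fresh := by
  unfold next at h
  split_ifs at h with h1 h2
  exact fun hv => h2 ⟨v, hv⟩

lemma mark_next_ne_done {s : State n m} {x : Fin n} (h : s.next = some x) : s.mark x ≠ .done := by
  rcases next_eq_some h with h | ⟨h, -⟩ <;> simp [h]

lemma mark_next_ne_aside {s : State n m} {x : Fin n} (h : s.next = some x) :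
    s.mark x ≠ .aside := by
  rcases next_eq_some h with h | ⟨h, -⟩ <;> simp [h]

/-- Explore the vertex `x`. -/
def pop (B : Bip n m) (s : State n m) (x : Fin n) : State n m where
  mark y := if y = x then .done
    else if s.mark y = .fresh ∧ ∃ i ∈ s.attrs, B (x, i) = true ∧ B (y, i) = true then .active
    else s.mark y
  attrs := s.attrs.filter fun i => ¬ B (x, i) = true

open Classical in
/-- Explore the next vertex, if `go` holds. -/
noncomputable def step (go : State n m → Prop) (B : Bip n m) (s : State n m) : State n m :=
  if go s then s.next.elim s (pop B s) else s

/-- Explore up to `N` vertices. -/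
noncomputable def run (go : State n m → Prop) : ℕ → State n m → Bip n m → State n m
  | 0, s, _ => s
  | N + 1, s, B => step go B (run go N s B)

/-- Case analysis for one step. -/
lemma step_cases (go : State n m → Prop) (B : Bip n m) (s : State n m) :
    step go B s = s ∨ ∃ x, go s ∧ s.next = some x ∧ step go B s = pop B s x := by
  unfold step
  split_ifs with h
  · cases hx : s.next with
    | none => exact Or.inl rfl
    | some x => exact Or.inr ⟨x, h, rfl, rfl⟩
  · exact Or.inl rfl

/-- The pairs that have no influence on the exploration before the state `s`. -/
def unrevealed (s : State n m) : Set (Fin n × Fin m) := {e | s.mark e.1 ≠ .done ∧ e.2 ∈ s.attrs}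

lemma unrevealed_pop (B : Bip n m) (s : State n m) (x : Fin n) :
    (pop B s x).unrevealed ⊆ s.unrevealed := by
  rintro ⟨v, i⟩ ⟨hv, hi⟩
  refine ⟨fun h => hv ?_, Finset.mem_of_mem_filter i hi⟩
  simp [pop, h]

lemma unrevealed_step (go : State n m → Prop) (B : Bip n m) (s : State n m) :
    (step go B s).unrevealed ⊆ s.unrevealed := by
  rcases step_cases go B s with h | ⟨x, -, -, h⟩
  · rw [h]
  · rw [h]
    exact unrevealed_pop B s x

lemma unrevealed_run (go : State n m → Prop) (N : ℕ) (B : Bip n m) (s : State n m) :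
    (run go N s B).unrevealed ⊆ s.unrevealed := by
  induction N with
  | zero => rfl
  | succ N ih => exact (unrevealed_step go B _).trans ih

/-- Exploring `x` reads the row of `x` and, at other vertices, only the attributes that `x` turns
out to have. -/
lemma pop_congr {s : State n m} {x : Fin n} {B B' : Bip n m}
    (h1 : ∀ i ∈ s.attrs, B (x, i) = B' (x, i))
    (h2 : ∀ i ∈ s.attrs, B (x, i) = true → ∀ y, s.mark y = .fresh → B (y, i) = B' (y, i)) :
    pop B s x = pop B' s x := by
  unfold pop
  congr 1
  · funext y
    split_ifs with hy h3 h4 h4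
    · rfl
    · rfl
    · obtain ⟨hf, i, hi, hx, hyi⟩ := h3
      exact absurd ⟨hf, i, hi, h1 i hi ▸ hx, h2 i hi hx y hf ▸ hyi⟩ h4
    · obtain ⟨hf, i, hi, hx, hyi⟩ := h4
      rw [← h1 i hi] at hx
      rw [← h2 i hi hx y hf] at hyi
      exact absurd ⟨hf, i, hi, hx, hyi⟩ h3
    · rfl
  · exact Finset.filter_congr fun i hi => by rw [h1 i hi]

lemma step_dependsOn (go : State n m → Prop) (s : State n m) :
    DependsOn (fun B => step go B s) s.unrevealed := by
  intro B B' h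
  unfold step
  split_ifs
  · cases hx : s.next with
    | none => rfl
    | some x =>
      exact pop_congr (fun i hi => h _ ⟨mark_next_ne_done hx, hi⟩)
        fun i hi _ y hy => h _ ⟨by simp [hy], hi⟩
  · rfl

/-- Whatever a step reads is revealed afterwards: `x` becomes done and its attributes leave `attrs`.
Thus the pairs revealed in the resulting state decide whether that state is reached, as
`integral_resample` requires. -/
lemma step_eq_of_revealed (go : State n m → Prop) (s : State n m) {B B' : Bip n m}
    (h : ∀ e ∈ (step go B s).unrevealedᶜ, B e = B' e) : step go B' s = step go B s := by
  unfold step at h ⊢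
  split_ifs at h ⊢
  · cases hx : s.next with
    | none => rfl
    | some x =>
      rw [hx] at h
      refine (pop_congr (fun i _ => h _ fun hu => hu.1 (by simp [pop]))
        fun i hi hxi y hy => h _ fun hu => ?_).symm
      exact (Finset.mem_filter.1 hu.2).2 hxi
  · rfl

lemma run_dependsOn (go : State n m → Prop) (N : ℕ) (s : State n m) :
    DependsOn (run go N s) s.unrevealed := by
  intro B B' h
  induction N with
  | zero => rfl
  | succ N ih =>
    simp only [run]
    rw [ih]
    exact step_dependsOn go _ fun e he => h e (unrevealed_run go N B' s he)

lemma run_eq_of_revealed (go : State n m → Prop) (N : ℕ) (s : State n m) {B B' : Bip n m}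
    (h : ∀ e ∈ (run go N s B).unrevealedᶜ, B e = B' e) : run go N s B' = run go N s B := by
  induction N with
  | zero => rfl
  | succ N ih =>
    simp only [run] at h ⊢
    rw [ih fun e he => h e fun hu => he (unrevealed_step go B _ hu)]
    exact step_eq_of_revealed go _ h

/-- The strong Markov property of the exploration. -/
lemma integral_run (p : Fin m → I) (go : State n m → Prop) (N : ℕ) (s : State n m)
    (g : State n m → Bip n m → ℝ)
    (hg : ∀ B, DependsOn (g (run go N s B)) (run go N s B).unrevealed) :
    ∫ B, g (run go N s B) B ∂bipLaw n p =
      ∫ B, ∫ B', g (run go N s B) B' ∂bipLaw n p ∂bipLaw n p := by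
  refine integral_resample p (run go N s) g (fun s' => s'.unrevealedᶜ) ?_ ?_
  · intro s' B B' h
    refine propext ⟨?_, ?_⟩
    · rintro rfl
      exact run_eq_of_revealed go N s h
    · rintro rfl
      exact run_eq_of_revealed go N s fun e he => (h e he).symm
  · intro B
    rw [compl_compl]
    exact hg B

/-- A function of the state that is a supermartingale for one step does not increase on average. -/
lemma integral_run_le (p : Fin m → I) (go : State n m → Prop) (N : ℕ) (s : State n m)
    (Φ : State n m → ℝ)
    (h : ∀ s x, go s → s.next = some x → ∫ B, Φ (pop B s x) ∂bipLaw n p ≤ Φ s) :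
    ∫ B, Φ (run go N s B) ∂bipLaw n p ≤ Φ s := by
  induction N with
  | zero => simp [run]
  | succ N ih =>
    refine le_trans ?_ ih
    simp only [run]
    rw [integral_run p go N s (fun s' B => Φ (step go B s'))
      fun B => fun B₁ B₂ h => congrArg Φ (step_dependsOn go _ h)]
    refine integral_mono (integrable_bip p _) (integrable_bip p _) fun B => ?_
    dsimp only
    unfold step
    split_ifs with hgo
    · cases hx : (run go N s B).next with
      | none => simp
      | some x => exact h _ x hgo hx
    · simp

/-! ### The effect of exploring one vertex -/

/-- The number of vertices that become active when `x` is explored. -/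
def found (B : Bip n m) (s : State n m) (x : Fin n) : ℕ :=
  (((s.verts .fresh).erase x).filter fun w =>
    ∃ i ∈ s.attrs, B (x, i) = true ∧ B (w, i) = true).card

lemma verts_done_pop (B : Bip n m) (s : State n m) (x : Fin n) :
    (pop B s x).verts .done = insert x (s.verts .done) := by
  ext y
  simp only [mem_verts, pop, Finset.mem_insert]
  split_ifs with h1 h2 <;> simp_all

lemma card_done_pop (B : Bip n m) {s : State n m} {x : Fin n} (hx : s.next = some x) :
    ((pop B s x).verts .done).card = (s.verts .done).card + 1 := by
  rw [verts_done_pop, Finset.card_insert_of_notMem]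
  simpa using mark_next_ne_done hx

lemma card_fresh_pop (B : Bip n m) (s : State n m) (x : Fin n) :
    found B s x + ((pop B s x).verts .fresh).card = ((s.verts .fresh).erase x).card := by
  rw [found, ← Finset.card_filter_add_card_filter_not (s := (s.verts .fresh).erase x)
    fun w => ∃ i ∈ s.attrs, B (x, i) = true ∧ B (w, i) = true]
  congr 2
  ext y
  simp only [mem_verts, pop, Finset.mem_filter, Finset.mem_erase]
  split_ifs with h1 h2
  · simp [h1]
  · simp [h2.2]
  · constructor
    · intro h
      exact ⟨⟨h1, h⟩, fun h' => h2 ⟨h, h'⟩⟩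
    · exact fun h => h.1.2

/-- The vertices set aside never change. -/
lemma verts_aside_pop (B : Bip n m) {s : State n m} {x : Fin n} (hx : s.next = some x) :
    (pop B s x).verts .aside = s.verts .aside := by
  have := mark_next_ne_aside hx
  ext y
  simp only [mem_verts, pop]
  split_ifs with h1 h2 <;> simp_all

lemma card_verts (s : State n m) : (s.verts .fresh).card + (s.verts .active).card +
    (s.verts .done).card + (s.verts .aside).card = n := by
  have h : (Finset.univ : Finset (Fin n)) =
      s.verts .fresh ∪ s.verts .active ∪ s.verts .done ∪ s.verts .aside := by
    ext v
    cases h : s.mark v <;> simp [h]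
  have := congrArg Finset.card h
  rw [Finset.card_union_of_disjoint, Finset.card_union_of_disjoint,
    Finset.card_union_of_disjoint, Finset.card_univ, Fintype.card_fin] at this
  · exact this.symm
  all_goals
    refine Finset.disjoint_left.2 fun v hv hv' => ?_
    simp only [Finset.mem_union, mem_verts] at hv hv'
    simp_all

end State

end RandomIntersection

/-! ### The two exponential supermartingales -/

namespace RandomIntersection

/-- The fraction of the attribute weight that may be lost during the exploration. -/
noncomputable def eps (c : ℝ) : ℝ := (c - 1) / (8 * c)

/-- The numerator of the exponential rate of the large deviation bounds. -/
noncomputable def rate (c : ℝ) : ℝ := eps c / (c + 1)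

lemma eps_pos {c : ℝ} (hc : 1 < c) : 0 < eps c := by
  apply div_pos <;> linarith

lemma rate_pos {c : ℝ} (hc : 1 < c) : 0 < rate c := div_pos (eps_pos hc) (by linarith)

lemma eps_lt {c : ℝ} (hc : 1 < c) : eps c < 1 / 8 := by
  unfold eps
  rw [div_lt_div_iff₀ (by linarith) (by norm_num)]
  linarith

lemma rate_lt {c : ℝ} (hc : 1 < c) : rate c < 1 / 16 := by
  unfold rate
  rw [div_lt_iff₀ (by linarith)]
  linarith [eps_lt hc]

/-- The standing assumptions on the parameters; `L` is an upper bound for the mean number of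
members of an attribute. -/
structure Regime (n : ℕ) {m : ℕ} (p : Fin m → I) (c L : ℝ) : Prop where
  one_lt : 1 < c
  one_le : 1 ≤ L
  pos : 0 < (n : ℝ)
  mul_le : ∀ i, n * (p i : ℝ) ≤ L
  sum_sq : n * ∑ i, (p i : ℝ) ^ 2 = c
  small : L / n ≤ rate c

namespace State

variable {n m : ℕ} (p : Fin m → I) (c : ℝ)

/-- The number of vertices that are no longer fresh, plus the mean number of members of the
attributes already used. -/
noncomputable def spent (s : State n m) : ℝ :=
  n - (s.verts .fresh).card + n * ∑ i ∈ s.attrsᶜ, (p i : ℝ)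

/-- The exponent of the lower tail potential. -/
noncomputable def low (s : State n m) : ℝ :=
  (s.verts .fresh).card + (1 + (c - 1) / 2) * (s.verts .done).card

/-- The exponent of the upper tail potential. -/
noncomputable def high (s : State n m) : ℝ := s.spent p - 8 * c * (s.verts .done).card

variable {p c}

lemma sum_coe_nonneg (F : Finset (Fin m)) : 0 ≤ ∑ i ∈ F, (p i : ℝ) :=
  Finset.sum_nonneg fun i _ => (p i).2.1

lemma mul_sum_sq_attrs_le {L : ℝ} (h : Regime n p c L) (s : State n m) :
    n * ∑ i ∈ s.attrs, (p i : ℝ) ^ 2 ≤ c := by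
  rw [← h.sum_sq]
  gcongr
  exact Finset.subset_univ _

/-- Because `n * p i ≤ L`, the used attributes have lost at most `L * ∑ p i ≤ L / n * s.spent p ≤
eps c` of the total weight `c`. -/
lemma le_mul_sum_sq_attrs {L : ℝ} (h : Regime n p c L) {s : State n m}
    (hs : s.spent p ≤ eps c * n / L) : (1 - eps c) * c ≤ n * ∑ i ∈ s.attrs, (p i : ℝ) ^ 2 := by
  have h1 : ((s.verts .fresh).card : ℝ) ≤ n := by
    exact_mod_cast (s.verts .fresh).card_le_univ.trans (by simp)
  have h0 := h.pos
  have hL : 0 < L := by linarith [h.one_le]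
  have h2 : n * ∑ i ∈ s.attrsᶜ, (p i : ℝ) ≤ eps c * n / L := by
    unfold spent at hs
    linarith
  have h3 : n * ∑ i ∈ s.attrsᶜ, (p i : ℝ) ^ 2 ≤ L * ∑ i ∈ s.attrsᶜ, (p i : ℝ) := by
    rw [Finset.mul_sum, Finset.mul_sum]
    refine Finset.sum_le_sum fun i _ => ?_
    nlinarith [mul_le_mul_of_nonneg_right (h.mul_le i) (p i).2.1]
  have h4 : L * ∑ i ∈ s.attrsᶜ, (p i : ℝ) ≤ eps c := by
    rw [le_div_iff₀ hL] at h2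
    have : n * (L * ∑ i ∈ s.attrsᶜ, (p i : ℝ)) ≤ n * eps c := by linarith
    exact le_of_mul_le_mul_left this h0
  have h5 := h.sum_sq
  rw [← Finset.sum_add_sum_compl s.attrs, mul_add] at h5
  nlinarith [eps_pos h.one_lt, h.one_lt]

lemma cast_card_fresh_pop (B : Bip n m) (s : State n m) (x : Fin n) :
    (((pop B s x).verts .fresh).card : ℝ) =
      ((s.verts .fresh).erase x).card - found B s x := by
  rw [← card_fresh_pop B s x]
  push_cast
  ring

/-- A step raises `low` by at most `1 + (c - 1) / 2` minus the number of vertices found, and the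
one-step lower tail bound compensates exactly this. The `+ 1` in the hypothesis allows for `x`
itself having been fresh. -/
lemma integral_exp_low_pop {L : ℝ} (h : Regime n p c L) {s : State n m} {x : Fin n}
    (hx : s.next = some x) (hs : s.spent p + 1 ≤ eps c * n / L) :
    ∫ B, Real.exp (rate c / L * (pop B s x).low c) ∂bipLaw n p ≤
      Real.exp (rate c / L * s.low c) := by
  have hL : 0 < L := by linarith [h.one_le]
  have hr := rate_pos h.one_lt
  have hlam : 0 < rate c / L := by positivity
  have hpt : ∀ B : Bip n m, Real.exp (rate c / L * (pop B s x).low c) ≤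
      Real.exp (rate c / L * (s.low c + (1 + (c - 1) / 2))) *
        Real.exp (-(rate c / L)) ^ found B s x := by
    intro B
    rw [← Real.exp_nat_mul, ← Real.exp_add, Real.exp_le_exp]
    have he : (((s.verts .fresh).erase x).card : ℝ) ≤ (s.verts .fresh).card := by
      exact_mod_cast Finset.card_le_card (Finset.erase_subset _ _)
    have : (pop B s x).low c ≤ s.low c + (1 + (c - 1) / 2) - found B s x := by
      unfold low
      rw [cast_card_fresh_pop, card_done_pop B hx]
      push_cast
      linarith
    have := mul_le_mul_of_nonneg_left this hlam.le
    linarith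
  refine (integral_mono (integrable_bip p _) (integrable_bip p _) hpt).trans ?_
  rw [integral_const_mul]
  have hfr : ((s.verts .fresh).card : ℝ) ≤ ((s.verts .fresh).erase x).card + 1 := by
    have := Finset.pred_card_le_card_erase (s := s.verts .fresh) (a := x)
    exact_mod_cast Nat.sub_le_iff_le_add.1 this
  have hsum := sum_coe_nonneg (p := p) s.attrsᶜ
  have hn := h.pos
  have hle : eps c * n / L ≤ eps c * n :=
    div_le_self (by have := eps_pos h.one_lt; positivity) h.one_le
  have hW : (1 - eps c) * n ≤ ((s.verts .fresh).erase x).card := by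
    have : 0 ≤ n * ∑ i ∈ s.attrsᶜ, (p i : ℝ) := by positivity
    unfold spent at hs
    linarith
  have key := integral_exp_neg_neighbours_le_exp p (Finset.notMem_erase x (s.verts .fresh)) s.attrs
    h.one_lt rfl rfl (lam := rate c / L) rfl h.one_le hn h.small h.mul_le hW
    (le_mul_sum_sq_attrs h (by linarith)) (mul_sum_sq_attrs_le h s)
  calc _ ≤ Real.exp (rate c / L * (s.low c + (1 + (c - 1) / 2))) *
        Real.exp (-(rate c / L) * (1 + (c - 1) / 2)) := by
        gcongr
        exact key
    _ = _ := by
      rw [← Real.exp_add]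
      ring_nf

/-- The vertices found and the attributes used cost at most `6 * c` in the exponent, and `x` costs
`1`; the drift `-8 * c` outweighs both. Unlike for `low`, no bound on `spent` is needed, as
shrinking `attrs` only helps. -/
lemma integral_exp_high_pop {L : ℝ} (h : Regime n p c L) {s : State n m} {x : Fin n}
    (hx : s.next = some x) :
    ∫ B, Real.exp (rate c / L * (pop B s x).high p c) ∂bipLaw n p ≤
      Real.exp (rate c / L * s.high p c) := by
  have hL : 0 < L := by linarith [h.one_le]
  have hr := rate_pos h.one_lt
  have hr1 := rate_lt h.one_lt
  have hlam : 0 < rate c / L := by positivity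
  have hlam1 : rate c / L ≤ 1 := by
    rw [div_le_one hL]
    linarith [h.one_le]
  have hpt : ∀ B : Bip n m, Real.exp (rate c / L * (pop B s x).high p c) ≤
      Real.exp (rate c / L * (s.high p c + 1 - 8 * c)) *
        (Real.exp (rate c / L) ^ found B s x *
        Real.exp (rate c / L * n * ∑ i ∈ s.attrs.filter (fun i => B (x, i) = true), (p i : ℝ))) := by
    intro B
    rw [← Real.exp_nat_mul, ← Real.exp_add, ← Real.exp_add, Real.exp_le_exp]
    have hfr : ((s.verts .fresh).card : ℝ) ≤ ((s.verts .fresh).erase x).card + 1 := by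
      have := Finset.pred_card_le_card_erase (s := s.verts .fresh) (a := x)
      exact_mod_cast Nat.sub_le_iff_le_add.1 this
    have hattr : ∑ i ∈ (pop B s x).attrsᶜ, (p i : ℝ) = ∑ i ∈ s.attrsᶜ, (p i : ℝ) +
        ∑ i ∈ s.attrs.filter (fun i => B (x, i) = true), (p i : ℝ) := by
      have h1 := Finset.sum_add_sum_compl s.attrs fun i => (p i : ℝ)
      have h2 := Finset.sum_add_sum_compl (pop B s x).attrs fun i => (p i : ℝ)
      have h3 := Finset.sum_filter_add_sum_filter_not s.attrs (fun i => B (x, i) = true)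
        fun i => (p i : ℝ)
      have h4 : (pop B s x).attrs = s.attrs.filter fun i => ¬ B (x, i) = true := rfl
      rw [h4] at h2 ⊢
      linarith
    have : (pop B s x).high p c ≤ s.high p c + 1 - 8 * c + found B s x +
        n * ∑ i ∈ s.attrs.filter (fun i => B (x, i) = true), (p i : ℝ) := by
      unfold high spent
      rw [cast_card_fresh_pop, card_done_pop B hx, hattr]
      push_cast
      linarith
    have := mul_le_mul_of_nonneg_left this hlam.le
    linarith
  refine (integral_mono (integrable_bip p _) (integrable_bip p _) hpt).trans ?_
  rw [integral_const_mul]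
  have key := integral_exp_neighbours_le_exp p (Finset.notMem_erase x (s.verts .fresh)) s.attrs
    hlam.le hlam1 (fun i => ?_) (mul_sum_sq_attrs_le h s)
  · calc _ ≤ Real.exp (rate c / L * (s.high p c + 1 - 8 * c)) *
          Real.exp (6 * (rate c / L) * c) := by
          gcongr
          exact key
      _ ≤ _ := by
        rw [← Real.exp_add, Real.exp_le_exp]
        have := mul_pos hlam (sub_pos.2 h.one_lt)
        nlinarith
  · have := mul_le_mul_of_nonneg_left (h.mul_le i) hlam.le
    have h2 : rate c / L * L = rate c := by field_simp
    linarith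

/-! ### Phases of the exploration -/

variable (p c)

/-- The state `s` is not a large deviation from the state `s₀`. -/
def Good (Λ : ℝ) (s₀ s : State n m) : Prop :=
  s.low c ≤ s₀.low c + Λ ∧ s.high p c ≤ s₀.high p c + Λ

/-- The exploration from `s₀` continues for `k` vertices unless there is a large deviation. -/
def Continues (Λ : ℝ) (k : ℕ) (s₀ s : State n m) : Prop :=
  Good p c Λ s₀ s ∧ (s.verts .done).card < (s₀.verts .done).card + k

/-- The state after the exploration of `k` vertices from `s₀`. -/
noncomputable def phase (Λ : ℝ) (k : ℕ) (s₀ : State n m) (B : Bip n m) : State n m :=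
  run (Continues p c Λ k s₀) k s₀ B

variable {p c}

/-- Control of `high` keeps a phase inside the range where `low` yields a supermartingale. -/
lemma Good.spent_le {Λ : ℝ} {s₀ s : State n m} (h : Good p c Λ s₀ s) (hc : 1 < c) {k : ℕ}
    (hk : (s.verts .done).card ≤ (s₀.verts .done).card + k) :
    s.spent p ≤ s₀.spent p + 8 * c * k + Λ := by
  have h1 := h.2
  have hk : ((s.verts .done).card : ℝ) ≤ (s₀.verts .done).card + k := by exact_mod_cast hk
  unfold high at h1
  nlinarith [mul_le_mul_of_nonneg_left hk (by linarith : 0 ≤ 8 * c)]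

-- Markov's inequality for the two exponentials. The run stops as soon as `Good` fails, so the final
-- state also records every earlier failure.
open Classical in
lemma integral_not_good_phase_le {L : ℝ} (h : Regime n p c L) {Λ : ℝ} {k : ℕ} {s₀ : State n m}
    (hs : s₀.spent p + 8 * c * k + Λ + 1 ≤ eps c * n / L) :
    ∫ B, (if Good p c Λ s₀ (phase p c Λ k s₀ B) then 0 else 1 : ℝ) ∂bipLaw n p ≤
      2 * Real.exp (-(rate c / L * Λ)) := by
  have hL : 0 < L := by linarith [h.one_le]
  have hr := rate_pos h.one_lt
  have hlam : 0 < rate c / L := by positivity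
  set r := rate c / L with hrdef
  have hlow := integral_run_le p (Continues p c Λ k s₀) k s₀
    (fun s => Real.exp (r * s.low c)) fun s x hgo hx => integral_exp_low_pop h hx (by
      have := hgo.1.spent_le h.one_lt hgo.2.le
      linarith)
  have hhigh := integral_run_le p (Continues p c Λ k s₀) k s₀
    (fun s => Real.exp (r * s.high p c)) fun s x _ hx => integral_exp_high_pop h hx
  have hpt : ∀ B, (if Good p c Λ s₀ (phase p c Λ k s₀ B) then 0 else 1 : ℝ) ≤
      Real.exp (-(r * (s₀.low c + Λ))) * Real.exp (r * (phase p c Λ k s₀ B).low c) +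
      Real.exp (-(r * (s₀.high p c + Λ))) * Real.exp (r * (phase p c Λ k s₀ B).high p c) := by
    intro B
    have e1 := Real.exp_pos (-(r * (s₀.low c + Λ)) + r * (phase p c Λ k s₀ B).low c)
    have e2 := Real.exp_pos (-(r * (s₀.high p c + Λ)) + r * (phase p c Λ k s₀ B).high p c)
    rw [← Real.exp_add, ← Real.exp_add]
    split_ifs with hG
    · positivity
    · unfold Good at hG
      rw [not_and_or, not_le, not_le] at hG
      rcases hG with hG | hG
      · have : 1 ≤ Real.exp (-(r * (s₀.low c + Λ)) + r * (phase p c Λ k s₀ B).low c) :=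
          Real.one_le_exp (by nlinarith)
        linarith
      · have : 1 ≤ Real.exp (-(r * (s₀.high p c + Λ)) + r * (phase p c Λ k s₀ B).high p c) :=
          Real.one_le_exp (by nlinarith)
        linarith
  refine (integral_mono (integrable_bip p _) (integrable_bip p _) hpt).trans ?_
  rw [integral_add (integrable_bip p _) (integrable_bip p _), integral_const_mul,
    integral_const_mul]
  have e1 := mul_le_mul_of_nonneg_left hlow (Real.exp_pos (-(r * (s₀.low c + Λ)))).le
  have e2 := mul_le_mul_of_nonneg_left hhigh (Real.exp_pos (-(r * (s₀.high p c + Λ)))).le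
  rw [← Real.exp_add] at e1 e2
  rw [show -(r * (s₀.low c + Λ)) + r * s₀.low c = -(r * Λ) by ring] at e1
  rw [show -(r * (s₀.high p c + Λ)) + r * s₀.high p c = -(r * Λ) by ring] at e2
  unfold phase
  linarith

end State

end RandomIntersection

/-! ### Deterministic consequences for the components -/

namespace RandomIntersection

namespace State

variable {n m : ℕ} {p : Fin m → I} {c : ℝ}

/-! ### Counting -/

lemma verts_aside_run (go : State n m → Prop) (N : ℕ) (s : State n m) (B : Bip n m) :
    (run go N s B).verts .aside = s.verts .aside := by
  induction N with
  | zero => rfl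
  | succ N ih =>
    rw [run, ← ih]
    rcases step_cases go B (run go N s B) with h | ⟨x, -, hx, h⟩
    · rw [h]
    · rw [h, verts_aside_pop B hx]

lemma verts_done_subset_run (go : State n m → Prop) (N : ℕ) (s : State n m) (B : Bip n m) :
    s.verts .done ⊆ (run go N s B).verts .done := by
  induction N with
  | zero => rfl
  | succ N ih =>
    refine ih.trans ?_
    rw [run]
    rcases step_cases go B (run go N s B) with h | ⟨x, -, -, h⟩
    · rw [h]
    · rw [h, verts_done_pop]
      exact Finset.subset_insert _ _

lemma mark_run_of_active (go : State n m → Prop) (N : ℕ) {s : State n m} {B : Bip n m} {v : Fin n}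
    (hv : s.mark v = .active) :
    (run go N s B).mark v = .active ∨ (run go N s B).mark v = .done := by
  induction N with
  | zero => exact Or.inl hv
  | succ N ih =>
    rw [run]
    rcases step_cases go B (run go N s B) with h | ⟨x, -, -, h⟩
    · rwa [h]
    · rw [h]
      simp only [pop]
      split_ifs
      · exact Or.inr rfl
      · exact Or.inl rfl
      · exact ih

lemma card_done_run_le (Λ : ℝ) (k N : ℕ) (s₀ : State n m) (B : Bip n m) :
    ((run (Continues p c Λ k s₀) N s₀ B).verts .done).card ≤ (s₀.verts .done).card + k := by
  induction N with
  | zero => exact Nat.le_add_right _ _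
  | succ N ih =>
    rw [run]
    rcases step_cases (Continues p c Λ k s₀) B (run (Continues p c Λ k s₀) N s₀ B) with
      h | ⟨x, hgo, hx, h⟩
    · rwa [h]
    · rw [h, card_done_pop B hx]
      exact hgo.2

lemma exists_fresh_of_spent_lt {s : State n m} (h : s.spent p < n) : ∃ v, s.mark v = .fresh := by
  by_contra hne
  push Not at hne
  have h1 : s.verts .fresh = ∅ := by
    ext v
    simpa using hne v
  have h2 := sum_coe_nonneg (p := p) s.attrsᶜ
  have : 0 ≤ (n : ℝ) * ∑ i ∈ s.attrsᶜ, (p i : ℝ) := by positivity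
  unfold spent at h
  rw [h1] at h
  simp only [Finset.card_empty, Nat.cast_zero] at h
  linarith

/-- A run that has stopped stays stopped, so `Good` at the end excludes an early stop by deviation;
running out of vertices is excluded because `spent < n` leaves a fresh one. -/
lemma card_done_phase {Λ : ℝ} {k : ℕ} {s₀ : State n m} {B : Bip n m} (hc : 1 < c)
    (hs : s₀.spent p + 8 * c * k + Λ < n) (hG : Good p c Λ s₀ (phase p c Λ k s₀ B)) :
    ((phase p c Λ k s₀ B).verts .done).card = (s₀.verts .done).card + k := by
  have key : ∀ N, ¬ Continues p c Λ k s₀ (run (Continues p c Λ k s₀) N s₀ B) ∨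
      ((run (Continues p c Λ k s₀) N s₀ B).verts .done).card = (s₀.verts .done).card + N := by
    intro N
    induction N with
    | zero => exact Or.inr rfl
    | succ N ih =>
      by_cases hgo : Continues p c Λ k s₀ (run (Continues p c Λ k s₀) N s₀ B)
      · have ih := ih.resolve_left (not_not.2 hgo)
        obtain ⟨v, hv⟩ := exists_fresh_of_spent_lt
          ((hgo.1.spent_le hc hgo.2.le).trans_lt hs)
        cases hx : (run (Continues p c Λ k s₀) N s₀ B).next with
        | none => exact absurd hv (next_eq_none hx v)
        | some x =>
          right
          rw [run, step, if_pos hgo, hx, Option.elim_some, card_done_pop B hx, ih]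
          ring
      · left
        rw [run, step, if_neg hgo]
        exact hgo
  refine le_antisymm (card_done_run_le Λ k k s₀ B) ?_
  rcases key k with h | h
  · by_contra hlt
    exact h ⟨hG, not_le.1 hlt⟩
  · exact h.ge

lemma card_eq_of_aside_eq {s s₀ : State n m} (h : s.verts .aside = s₀.verts .aside) :
    (((s.verts .fresh).card + (s.verts .active).card + (s.verts .done).card : ℕ) : ℝ) =
      ((s₀.verts .fresh).card + (s₀.verts .active).card + (s₀.verts .done).card : ℕ) := by
  have h1 := card_verts s
  have h2 := card_verts s₀
  rw [h] at h1
  norm_cast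
  omega

/-- A successful phase ends with many active vertices. -/
lemma le_card_active_phase {Λ : ℝ} {k : ℕ} {s₀ : State n m} {B : Bip n m} (hc : 1 < c)
    (hs : s₀.spent p + 8 * c * k + Λ < n) (hG : Good p c Λ s₀ (phase p c Λ k s₀ B)) :
    (c - 1) / 2 * k - Λ ≤ ((phase p c Λ k s₀ B).verts .active).card := by
  -- The number of vertices not set aside is conserved, so the bound on `low`, which says that few
  -- are fresh, says that many are active.
  have h1 := card_eq_of_aside_eq (verts_aside_run (Continues p c Λ k s₀) k s₀ B)
  have h2 := hG.1
  unfold low at h2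
  have h3 : (((phase p c Λ k s₀ B).verts .done).card : ℝ) = (s₀.verts .done).card + k := by
    exact_mod_cast card_done_phase hc hs hG
  rw [h3] at h2
  change (((((phase p c Λ k s₀ B).verts .fresh).card + ((phase p c Λ k s₀ B).verts .active).card +
    ((phase p c Λ k s₀ B).verts .done).card : ℕ)) : ℝ) = _ at h1
  push_cast at h1
  rw [h3] at h1
  have : (0 : ℝ) ≤ (s₀.verts .active).card := Nat.cast_nonneg _
  linarith

/-! ### Consistency of the exploration with the graph -/

/-- Explored vertices have no unused attributes, and fresh vertices no used ones. -/
def Consistent (s : State n m) (B : Bip n m) : Prop :=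
  (∀ v i, s.mark v = .done → i ∈ s.attrs → B (v, i) = false) ∧
    ∀ v i, s.mark v = .fresh → i ∉ s.attrs → B (v, i) = false

lemma Consistent.pop {s : State n m} {B : Bip n m} (h : Consistent s B) (x : Fin n) :
    Consistent (pop B s x) B := by
  constructor
  · intro v i hv hi
    have hi' := Finset.mem_filter.1 hi
    simp only [State.pop] at hv
    split_ifs at hv with h1 h2
    · subst h1
      simpa using hi'.2
    · exact h.1 v i hv hi'.1
  · intro v i hv hi
    simp only [State.pop] at hv
    split_ifs at hv with h1 h2
    by_cases his : i ∈ s.attrs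
    · by_contra hB
      refine h2 ⟨hv, i, his, ?_, by simpa using hB⟩
      by_contra hx
      exact hi (Finset.mem_filter.2 ⟨his, hx⟩)
    · exact h.2 v i hv his

lemma Consistent.run {s : State n m} {B : Bip n m} (h : Consistent s B) (go : State n m → Prop)
    (N : ℕ) : Consistent (run go N s B) B := by
  induction N with
  | zero => exact h
  | succ N ih =>
    rw [State.run]
    rcases step_cases go B (State.run go N s B) with h' | ⟨x, -, -, h'⟩
    · rwa [h']
    · rw [h']
      exact ih.pop x

lemma Consistent.not_adj {s : State n m} {B : Bip n m} (h : Consistent s B) {v w : Fin n}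
    (hv : s.mark v = .done) (hw : s.mark w = .fresh) : ¬ (interGraph B).Adj v w := by
  rintro ⟨-, i, h1, h2⟩
  by_cases hi : i ∈ s.attrs
  · rw [h.1 v i hv hi] at h1
    exact absurd h1 (by simp)
  · rw [h.2 w i hw hi] at h2
    exact absurd h2 (by simp)

/-- What is known about the graph after part of a phase has been carried out: apart from a small
set `Q` that is closed up to vertices set aside, all vertices found in this phase belong to one
component. -/
structure Explored (s₀ s : State n m) (B : Bip n m) (q : ℝ) (Q : Finset (Fin n)) : Prop where
  card_le : Q.card ≤ q
  done : ∀ x ∈ Q, s.mark x = .done ∧ s₀.mark x ≠ .done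
  closed : ∀ x ∈ Q, ∀ y, (interGraph B).Adj x y → y ∈ Q ∨ s₀.mark y = .aside
  reachable : ∀ x y, (s.mark x = .active ∨ s.mark x = .done ∧ s₀.mark x ≠ .done) → x ∉ Q →
    (s.mark y = .active ∨ s.mark y = .done ∧ s₀.mark y ≠ .done) → y ∉ Q →
    (interGraph B).Reachable x y

/-- The conditions on the initial state of a phase. -/
structure IsStart (s₀ : State n m) (B : Bip n m) : Prop where
  consistent : Consistent s₀ B
  active : ∀ v i, s₀.mark v = .active → i ∉ s₀.attrs → B (v, i) = false
  unique : ∀ v w, s₀.mark v = .active → s₀.mark w = .active → v = w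

lemma IsStart.not_adj {s₀ : State n m} {B : Bip n m} (h : IsStart s₀ B) {v w : Fin n}
    (hv : s₀.mark v = .done) (hw : s₀.mark w ≠ .done) (hw' : s₀.mark w ≠ .aside) :
    ¬ (interGraph B).Adj w v := by
  intro hadj
  cases hm : s₀.mark w with
  | fresh => exact h.consistent.not_adj hv hm hadj.symm
  | active =>
    obtain ⟨-, i, h1, h2⟩ := hadj
    by_cases hi : i ∈ s₀.attrs
    · rw [h.consistent.1 v i hv hi] at h2
      exact absurd h2 (by simp)
    · rw [h.active w i hm hi] at h1
      exact absurd h1 (by simp)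
  | done => exact hw hm
  | aside => exact hw' hm

lemma reachable_of_forall {V : Type*} {G : SimpleGraph V} {P : V → Prop} {x : V}
    (h : ∀ y, P y → G.Reachable x y) (y z : V) (hy : P y) (hz : P z) : G.Reachable y z :=
  (h y hy).symm.trans (h z hz)

/-- Vertices found from an active `x` are adjacent to `x`, hence join the current component. -/
lemma Explored.pop_active {s₀ s : State n m} {B : Bip n m} {q : ℝ} {Q : Finset (Fin n)}
    (h : Explored s₀ s B q Q) {x : Fin n} (hx : s.mark x = .active) :
    Explored s₀ (pop B s x) B q Q := by
  have hxQ : x ∉ Q := fun hxQ => by simpa [hx] using (h.done x hxQ).1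
  refine ⟨h.card_le, fun y hy => ⟨?_, (h.done y hy).2⟩, h.closed, ?_⟩
  · simp [State.pop, (h.done y hy).1]
  · have key : ∀ y, (((pop B s x).mark y = .active ∨
        (pop B s x).mark y = .done ∧ s₀.mark y ≠ .done) ∧ y ∉ Q) →
        (interGraph B).Reachable x y := by
      rintro y ⟨hy, hyQ⟩
      simp only [State.pop] at hy
      split_ifs at hy with h1 h2
      · rw [h1]
      · obtain ⟨-, i, -, h3, h4⟩ := h2
        exact SimpleGraph.Adj.reachable ⟨fun h => h1 h.symm, i, h3, h4⟩
      · exact h.reachable x y (Or.inl hx) hxQ hy hyQ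
    exact fun y z hy hyQ hz hzQ => reachable_of_forall key y z ⟨hy, hyQ⟩ ⟨hz, hzQ⟩

/-- With no active vertex left, all that the phase has explored is closed off and becomes the new
`Q`; the current component starts again at `x`. -/
lemma Explored.pop_fresh {s₀ s : State n m} {B : Bip n m} {q : ℝ} (h₀ : IsStart s₀ B)
    (hs : Consistent s B) (haside : s.verts .aside = s₀.verts .aside)
    {x : Fin n} (hact : ∀ v, s.mark v ≠ .active)
    (hq : ((s.verts .done \ s₀.verts .done).card : ℝ) ≤ q) :
    Explored s₀ (pop B s x) B q (s.verts .done \ s₀.verts .done) := by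
  have has : ∀ v, s.mark v = .aside ↔ s₀.mark v = .aside := fun v => by
    simpa using Finset.ext_iff.1 haside v
  refine ⟨hq, fun y hy => ?_, fun y hy z hadj => ?_, ?_⟩
  · simp only [Finset.mem_sdiff, mem_verts] at hy
    exact ⟨by simp [State.pop, hy.1], hy.2⟩
  · simp only [Finset.mem_sdiff, mem_verts] at hy ⊢
    have hya : s₀.mark y ≠ .aside := fun h => by simpa [hy.1] using (has y).2 h
    cases hz : s.mark z with
    | fresh => exact absurd hadj (hs.not_adj hy.1 hz)
    | active => exact absurd hz (hact z)
    | done =>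
      exact Or.inl ⟨rfl, fun hz₀ => h₀.not_adj hz₀ hy.2 hya hadj⟩
    | aside => exact Or.inr ((has z).1 hz)
  · have key : ∀ y, (((pop B s x).mark y = .active ∨
        (pop B s x).mark y = .done ∧ s₀.mark y ≠ .done) ∧ y ∉ s.verts .done \ s₀.verts .done) →
        (interGraph B).Reachable x y := by
      rintro y ⟨hy, hyQ⟩
      simp only [Finset.mem_sdiff, mem_verts] at hyQ
      simp only [State.pop] at hy
      split_ifs at hy with h1 h2
      · rw [h1]
      · obtain ⟨-, i, -, h3, h4⟩ := h2
        exact SimpleGraph.Adj.reachable ⟨fun h => h1 h.symm, i, h3, h4⟩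
      · exact absurd hy fun h => h.elim (hact y) hyQ
    exact fun y z hy hyQ hz hzQ => reachable_of_forall key y z ⟨hy, hyQ⟩ ⟨hz, hzQ⟩

/-- A fresh vertex is chosen only when no vertex is active. If `j` vertices were explored by then,
conservation and the bound on `low` give `(c - 1) / 2 * j ≤ Λ`, so the closed part is small. -/
lemma exists_explored_run {Λ : ℝ} {k : ℕ} {s₀ : State n m} {B : Bip n m} (hc : 1 < c)
    (hΛ : 0 ≤ Λ) (h₀ : IsStart s₀ B) (N : ℕ) :
    ∃ Q, Explored s₀ (run (Continues p c Λ k s₀) N s₀ B) B (2 * Λ / (c - 1)) Q := by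
  have hc1 : 0 < c - 1 := by linarith
  induction N with
  | zero =>
    refine ⟨∅, by simpa using by positivity, by simp, by simp, fun x y hx _ hy _ => ?_⟩
    simp only [run] at hx hy
    have hx : s₀.mark x = .active := hx.resolve_right fun h => h.2 h.1
    have hy : s₀.mark y = .active := hy.resolve_right fun h => h.2 h.1
    rw [h₀.unique x y hx hy]
  | succ N ih =>
    obtain ⟨Q, hQ⟩ := ih
    rw [run]
    rcases step_cases (Continues p c Λ k s₀) B (run (Continues p c Λ k s₀) N s₀ B) with
      h | ⟨x, hgo, hx, h⟩
    · exact ⟨Q, by rwa [h]⟩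
    · rw [h]
      rcases next_eq_some hx with hx | ⟨-, hact⟩
      · exact ⟨Q, hQ.pop_active hx⟩
      · have haside := verts_aside_run (Continues p c Λ k s₀) N s₀ B
        have hdone := verts_done_subset_run (Continues p c Λ k s₀) N s₀ B
        refine ⟨_, Explored.pop_fresh h₀ (h₀.consistent.run _ N) haside (x := x) hact ?_⟩
        rw [Finset.cast_card_sdiff hdone]
        have h1 := card_eq_of_aside_eq haside
        have h2 := hgo.1.1
        have h3 : (run (Continues p c Λ k s₀) N s₀ B).verts .active = ∅ := by
          ext v
          simpa using hact v
        rw [h3] at h1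
        unfold low at h2
        push_cast [Finset.card_empty] at h1
        have : (0 : ℝ) ≤ (s₀.verts .active).card := Nat.cast_nonneg _
        rw [le_div_iff₀ hc1]
        linarith

/-! ### The two phases -/

variable (n m) in
/-- The state in which nothing has been explored. -/
def init : State n m := ⟨fun _ => .fresh, Finset.univ⟩

/-- Put the active vertices aside, and make `v` the only active vertex. -/
def restart (s : State n m) (v : Fin n) : State n m where
  mark y := if y = v then .active else if s.mark y = .active then .aside else s.mark y
  attrs := s.attrs

lemma isStart_init (B : Bip n m) : IsStart (init n m) B :=
  ⟨⟨by simp [init], by simp [init]⟩, by simp [init], by simp [init]⟩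

lemma isStart_restart {s : State n m} {B : Bip n m} (h : Consistent s B) {v : Fin n}
    (hv : s.mark v = .fresh) : IsStart (s.restart v) B := by
  refine ⟨⟨fun w i hw hi => ?_, fun w i hw hi => ?_⟩, fun w i hw hi => ?_, fun w w' hw hw' => ?_⟩
  · simp only [restart] at hw
    split_ifs at hw
    exact h.1 w i hw hi
  · simp only [restart] at hw
    split_ifs at hw
    exact h.2 w i hw hi
  · simp only [restart] at hw
    split_ifs at hw with h1 h2
    · exact h.2 w i (h1 ▸ hv) hi
    · exact absurd hw h2
  · simp only [restart] at hw hw'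
    have key : ∀ u, (if u = v then Mark.active else if s.mark u = .active then .aside
        else s.mark u) = .active → u = v := fun u hu => by
      split_ifs at hu with h1 h2
      · exact h1
      · exact absurd hu h2
    rw [key w hw, key w' hw']

/-- Some unused attribute links the active vertices to those put aside. -/
def Linked (s : State n m) (B : Bip n m) : Prop :=
  ∃ i ∈ s.attrs, (∃ v ∈ s.verts .aside, B (v, i) = true) ∧ ∃ v ∈ s.verts .active, B (v, i) = true

end State

lemma mem_of_reachable {V : Type*} {G : SimpleGraph V} {Q : Set V}
    (hQ : ∀ x ∈ Q, ∀ y, G.Adj x y → y ∈ Q) {x y : V} (hx : x ∈ Q) (h : G.Reachable x y) :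
    y ∈ Q := by
  obtain ⟨w⟩ := h
  induction w with
  | nil => exact hx
  | cons hadj _ ih => exact ih (hQ _ hx _ hadj)

lemma compSize_mk_le {V : Type*} {G : SimpleGraph V} {Q : Finset V} {x : V}
    (hQ : ∀ y, G.Reachable x y → y ∈ Q) : compSize (G.connectedComponentMk x) ≤ Q.card := by
  unfold compSize
  rw [← Set.ncard_coe_finset Q]
  refine Set.ncard_le_ncard (fun y hy => ?_) Q.finite_toSet
  exact hQ y (SimpleGraph.ConnectedComponent.exact hy).symm

-- The giant is the component of any vertex `r` active after the first phase. A vertex `v` outside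
-- it lies in the small closed set `Q` or is fresh. In the latter case the second phase from `v`
-- either catches `v` in a small set `Q₂`, or connects it to the final active vertices, and then the
-- link would put it into the giant.
open State in
lemma hasUniqueGiant_of_phases {n m : ℕ} {p : Fin m → I} {c : ℝ} {B : Bip n m} {Λ : ℝ} {k : ℕ}
    {a : ℝ} (hc : 1 < c) (hΛ : 0 ≤ Λ) (ha : 2 * Λ / (c - 1) < a)
    (hs : (init n m).spent p + 8 * c * k + Λ < n) (hk : a ≤ (c - 1) / 2 * k - Λ)
    (h₁ : Good p c Λ (init n m) (phase p c Λ k (init n m) B))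
    (h₂ : ∀ v, (phase p c Λ k (init n m) B).mark v = .fresh →
      Linked (phase p c Λ k ((phase p c Λ k (init n m) B).restart v) B) B) :
    HasUniqueGiant (interGraph B) a (2 * Λ / (c - 1)) := by
  have hc1 : 0 < c - 1 := by linarith
  set s₁ := phase p c Λ k (init n m) B with hs₁
  have hcard := hk.trans (le_card_active_phase hc hs h₁)
  rw [← hs₁] at hcard
  have hapos : 0 < a := lt_of_le_of_lt (by positivity) ha
  have hne : (s₁.verts .active).Nonempty := by
    rw [← Finset.card_pos]
    exact_mod_cast hapos.trans_le hcard
  obtain ⟨r, hr⟩ := hne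
  rw [mem_verts] at hr
  obtain ⟨Q, hQ⟩ := exists_explored_run (p := p) (k := k) hc hΛ (isStart_init B) k
  change Explored (init n m) s₁ B _ Q at hQ
  have hact : ∀ v, s₁.mark v = .active → v ∉ Q := fun v hv hvQ => by
    simpa [hv] using (hQ.done v hvQ).1
  have hreach : ∀ v, (s₁.mark v = .active ∨ s₁.mark v = .done) → v ∉ Q →
      (interGraph B).Reachable r v := fun v hv hvQ =>
    hQ.reachable r v (Or.inl hr) (hact r hr) (hv.imp id fun h => ⟨h, by simp [init]⟩) hvQ
  refine ⟨(interGraph B).connectedComponentMk r, ?_, ?_⟩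
  · refine hcard.trans ?_
    unfold compSize
    rw [← Set.ncard_coe_finset (s₁.verts .active), Nat.cast_le]
    refine Set.ncard_le_ncard (fun v hv => ?_) (Set.toFinite _)
    have hv : s₁.mark v = .active := mem_verts.1 hv
    exact SimpleGraph.ConnectedComponent.sound (hreach v (Or.inl hv) (hact v hv)).symm
  · intro K' hK'
    suffices h : (compSize K' : ℝ) ≤ 2 * Λ / (c - 1) from ⟨h.trans_lt ha, h⟩
    induction K' using SimpleGraph.ConnectedComponent.ind with | _ v
    have hrv : ¬ (interGraph B).Reachable r v := fun h =>
      hK' (SimpleGraph.ConnectedComponent.sound h.symm)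
    by_cases hvQ : v ∈ Q
    · refine le_trans ?_ hQ.card_le
      exact_mod_cast compSize_mk_le fun y hy => mem_of_reachable (Q := (Q : Set (Fin n)))
        (fun x hx y hadj => (hQ.closed x hx y hadj).resolve_right (by simp [init])) hvQ hy
    · have hfresh : s₁.mark v = .fresh := by
        cases hm : s₁.mark v with
        | fresh => rfl
        | active => exact absurd (hreach v (Or.inl hm) hvQ) hrv
        | done => exact absurd (hreach v (Or.inr hm) hvQ) hrv
        | aside =>
          have := Finset.ext_iff.1 (verts_aside_run (Continues p c Λ k (init n m)) k (init n m) B) v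
          change v ∈ s₁.verts .aside ↔ _ at this
          simp [hm, init] at this
      have hstart : IsStart (s₁.restart v) B :=
        isStart_restart ((isStart_init B).consistent.run _ k) hfresh
      obtain ⟨Q₂, hQ₂⟩ := exists_explored_run (p := p) (k := k) hc hΛ hstart k
      obtain ⟨i, -, ⟨x, hx, hxi⟩, ⟨y, hy, hyi⟩⟩ := h₂ v hfresh
      change Explored _ (phase p c Λ k (s₁.restart v) B) B _ Q₂ at hQ₂
      set s₂ := phase p c Λ k (s₁.restart v) B with hs₂
      have haside : ∀ w, s₂.mark w = .aside ↔ (s₁.restart v).mark w = .aside := fun w => by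
        have h := Finset.ext_iff.1 (verts_aside_run
          (Continues p c Λ k (s₁.restart v)) k (s₁.restart v) B) w
        rwa [mem_verts, mem_verts] at h
      have haside' : ∀ w, (s₁.restart v).mark w = .aside → (interGraph B).Reachable r w := by
        intro w hw
        have : s₁.mark w = .active := by
          simp only [restart] at hw
          split_ifs at hw with h1 h2
          · exact h2
          · have := Finset.ext_iff.1
              (verts_aside_run (Continues p c Λ k (init n m)) k (init n m) B) w
            change w ∈ s₁.verts .aside ↔ _ at this
            simp [hw, init] at this
        exact hreach w (Or.inl this) (hact w this)
      rw [mem_verts] at hx hy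
      have hrx := haside' x ((haside x).1 hx)
      by_cases hvQ₂ : v ∈ Q₂
      · refine le_trans ?_ hQ₂.card_le
        -- Edges leave `Q₂` only towards vertices set aside, which belong to the giant; removing the
        -- giant from `Q₂` makes it closed.
        have hcl : ∀ x ∈ {w | w ∈ Q₂ ∧ ¬ (interGraph B).Reachable r w}, ∀ y,
            (interGraph B).Adj x y → y ∈ {w | w ∈ Q₂ ∧ ¬ (interGraph B).Reachable r w} := by
          rintro x ⟨hx, hrx⟩ y hadj
          have hry : ¬ (interGraph B).Reachable r y := fun h =>
            hrx (h.trans hadj.symm.reachable)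
          exact ⟨(hQ₂.closed x hx y hadj).resolve_right fun h => hry (haside' y h), hry⟩
        exact_mod_cast compSize_mk_le fun y hy => (mem_of_reachable hcl ⟨hvQ₂, hrv⟩ hy).1
      · exfalso
        have hv₀ : (s₁.restart v).mark v = .active := by simp [restart]
        have hvs : s₂.mark v = .active ∨ s₂.mark v = .done ∧ (s₁.restart v).mark v ≠ .done :=
          (mark_run_of_active _ _ hv₀).imp id fun h => ⟨h, by simp [hv₀]⟩
        have hvy := hQ₂.reachable v y hvs hvQ₂ (Or.inl hy) fun h => by
          simpa [hy] using (hQ₂.done y h).1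
        have hxy : (interGraph B).Reachable x y := by
          by_cases hxy : x = y
          · rw [hxy]
          · exact SimpleGraph.Adj.reachable ⟨hxy, i, hxi, hyi⟩
        exact hrv (hrx.trans (hxy.trans hvy.symm))

end RandomIntersection

/-! ### Failure probability of the two phases -/

namespace RandomIntersection

namespace State

variable {n m : ℕ} {p : Fin m → I} {c : ℝ}

lemma spent_init : (init n m).spent p = 0 := by
  have : (init n m).verts .fresh = Finset.univ := by
    ext v
    simp [init]
  simp only [spent, this]
  simp [init]

lemma spent_restart {s : State n m} {v : Fin n} (hv : s.mark v = .fresh) :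
    (s.restart v).spent p = s.spent p + 1 := by
  have h1 : (s.restart v).verts .fresh = (s.verts .fresh).erase v := by
    ext w
    simp only [mem_verts, restart, Finset.mem_erase]
    split_ifs with h1 h2 <;> simp_all
  have h2 : (((s.verts .fresh).erase v).card : ℝ) + 1 = (s.verts .fresh).card := by
    exact_mod_cast Finset.card_erase_add_one (mem_verts.2 hv)
  unfold spent
  rw [h1, ← h2]
  simp only [restart]
  ring

lemma unrevealed_restart_subset {s : State n m} {v : Fin n} (hv : s.mark v = .fresh) :
    (s.restart v).unrevealed ⊆ s.unrevealed := by
  rintro ⟨w, i⟩ ⟨hw, hi⟩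
  refine ⟨fun h => hw ?_, hi⟩
  have : w ≠ v := fun h' => by
    subst h'
    simp [hv] at h
  simp only at h
  simp [restart, this, h]

lemma card_active_le_card_aside_restart {s : State n m} {v : Fin n} (hv : s.mark v = .fresh) :
    (s.verts .active).card ≤ ((s.restart v).verts .aside).card := by
  refine Finset.card_le_card fun w hw => ?_
  rw [mem_verts] at hw ⊢
  have : w ≠ v := fun h' => by
    subst h'
    simp [hv] at hw
  simp [restart, this, hw]

/-- Makes the strong Markov property applicable to linking: active and set-aside vertices are not
done, so their pairs with unused attributes are unrevealed. -/
lemma linked_congr (s : State n m) {B B' : Bip n m} (h : ∀ e ∈ s.unrevealed, B e = B' e) :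
    Linked s B ↔ Linked s B' := by
  unfold Linked
  refine exists_congr fun i => and_congr_right fun hi => ?_
  refine and_congr (exists_congr fun v => and_congr_right fun hv => ?_)
    (exists_congr fun v => and_congr_right fun hv => ?_) <;>
  · rw [mem_verts] at hv
    rw [h (v, i) ⟨by simp [hv], hi⟩]

open Classical in
/-- A second phase started from a fresh vertex is likely to be successful. -/
lemma integral_restart_le {L Λ t : ℝ} {k : ℕ} (h : Regime n p c L) {s : State n m} {v : Fin n}
    (hv : s.mark v = .fresh) (hs : s.spent p ≤ 8 * c * k + Λ)
    (hroom : 16 * c * k + 2 * Λ + 2 ≤ eps c * n / L) (hts : t ≤ (s.verts .active).card)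
    (ht : t ≤ (c - 1) / 2 * k - Λ) (ht0 : 0 ≤ t) (htL : t ≤ n / L) :
    ∫ B, (if Good p c Λ (s.restart v) (phase p c Λ k (s.restart v) B) ∧
        Linked (phase p c Λ k (s.restart v) B) B then 0 else 1 : ℝ) ∂bipLaw n p ≤
      2 * Real.exp (-(rate c / L * Λ)) + Real.exp (-(t ^ 2 / (8 * n))) := by
  have hc := h.one_lt
  have hn := h.pos
  have hL : 0 < L := by linarith [h.one_le]
  -- The room covers `8 * c * k + Λ` for each of the two phases, `1` for making `v` active, and `1`
  -- for the step bound.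
  have hsr : (s.restart v).spent p + 8 * c * k + Λ + 1 ≤ eps c * n / L := by
    rw [spent_restart hv]
    linarith
  have hlt : (s.restart v).spent p + 8 * c * k + Λ < n := by
    have h1 : eps c * n / L ≤ eps c * n :=
      div_le_self (by have := eps_pos hc; positivity) h.one_le
    have := mul_le_mul_of_nonneg_right (eps_lt hc).le hn.le
    linarith
  set s₀ := s.restart v with hs₀
  have h1 := integral_not_good_phase_le h hsr
  have h2 : ∫ B, (if Good p c Λ s₀ (phase p c Λ k s₀ B) then
      (if Linked (phase p c Λ k s₀ B) B then 0 else 1) else 0 : ℝ) ∂bipLaw n p ≤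
      Real.exp (-(t ^ 2 / (8 * n))) := by
    have hmarkov := integral_run p (Continues p c Λ k s₀) k s₀
      (fun s' B => if Good p c Λ s₀ s' then (if Linked s' B then 0 else 1) else 0 : State n m → Bip n m → ℝ)
      fun B B₁ B₂ hB => by simp only [linked_congr _ hB]
    unfold phase
    rw [hmarkov]
    refine le_trans (integral_mono (integrable_bip p _)
      (integrable_bip p fun _ => Real.exp (-(t ^ 2 / (8 * n)))) fun B => ?_) (by simp)
    by_cases hG : Good p c Λ s₀ (run (Continues p c Λ k s₀) k s₀ B)
    · simp only [if_pos hG]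
      have hact := ht.trans (le_card_active_phase hc hlt hG)
      unfold phase at hact
      have haside := verts_aside_run (Continues p c Λ k s₀) k s₀ B
      have hspent := hG.spent_le hc (card_done_run_le Λ k k s₀ B)
      set s₂ := run (Continues p c Λ k s₀) k s₀ B
      have hF := le_mul_sum_sq_attrs h (s := s₂) (by linarith)
      refine le_trans (le_of_eq ?_) <| (integral_not_linked_le p (A := s₂.verts .aside) (A' := s₂.verts .active) ?_ s₂.attrs
        (t := t) ?_ hact (fun i => ?_) ht0).trans ?_
      · unfold Linked
        congr 1
        funext B'
        congr
      · refine Finset.disjoint_left.2 fun w hw hw' => ?_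
        rw [mem_verts] at hw hw'
        simp [hw] at hw'
      · rw [haside]
        refine hts.trans ?_
        exact_mod_cast card_active_le_card_aside_restart hv
      · calc t * (p i : ℝ) ≤ n / L * p i := mul_le_mul_of_nonneg_right htL (p i).2.1
          _ = n * p i / L := by ring
          _ ≤ 1 := by
            rw [div_le_one hL]
            exact h.mul_le i
      · rw [Real.exp_le_exp, neg_le_neg_iff]
        -- The unused attributes keep weight `(1 - eps c) * c > 7 / 8`; half is enough for the
        -- exponent `t² / 4 * (1 / (2 * n))`.
        have h3 : 1 / 2 ≤ n * ∑ i ∈ s₂.attrs, (p i : ℝ) ^ 2 := by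
          nlinarith [eps_lt hc]
        have h4 : 1 / (2 * n) ≤ ∑ i ∈ s₂.attrs, (p i : ℝ) ^ 2 := by
          rw [div_le_iff₀ (by positivity)]
          linarith
        calc t ^ 2 / (8 * n) = t ^ 2 / 4 * (1 / (2 * n)) := by
              field_simp
              ring
          _ ≤ _ := by gcongr
    · simp only [if_neg hG, integral_zero]
      positivity
  have hpt : ∀ B, (if Good p c Λ s₀ (phase p c Λ k s₀ B) ∧
        Linked (phase p c Λ k s₀ B) B then 0 else 1 : ℝ) ≤
      (if Good p c Λ s₀ (phase p c Λ k s₀ B) then 0 else 1) +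
      (if Good p c Λ s₀ (phase p c Λ k s₀ B) then
        (if Linked (phase p c Λ k s₀ B) B then 0 else 1) else 0) := by
    intro B
    by_cases hG : Good p c Λ s₀ (phase p c Λ k s₀ B) <;>
    by_cases hl : Linked (phase p c Λ k s₀ B) B <;> simp [hG, hl]
  refine (integral_mono (integrable_bip p _) (integrable_bip p _) hpt).trans ?_
  rw [integral_add (integrable_bip p _) (integrable_bip p _)]
  linarith

end State

open State in
open Classical in
/-- A quantitative, non-asymptotic form of the main theorem. -/
lemma integral_not_hasUniqueGiant_le {n m : ℕ} {p : Fin m → I} {c L Λ t : ℝ} {k : ℕ}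
    (h : Regime n p c L) (hΛ : 0 ≤ Λ) (hroom : 16 * c * k + 2 * Λ + 2 ≤ eps c * n / L)
    (ht : t ≤ (c - 1) / 2 * k - Λ) (htΛ : 2 * Λ / (c - 1) < t) (htL : t ≤ n / L) :
    ∫ B, (if HasUniqueGiant (interGraph B) t (2 * Λ / (c - 1)) then 0 else 1 : ℝ) ∂bipLaw n p ≤
      2 * Real.exp (-(rate c / L * Λ)) +
        n * (2 * Real.exp (-(rate c / L * Λ)) + Real.exp (-(t ^ 2 / (8 * n)))) := by
  have hc := h.one_lt
  have hn := h.pos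
  have hL : 0 < L := by linarith [h.one_le]
  have hc1 : 0 < c - 1 := by linarith
  have ht0 : 0 ≤ t := (lt_of_le_of_lt (by positivity) htΛ).le
  have hck : 0 ≤ c * k := by positivity
  have hs : (init n m).spent p + 8 * c * k + Λ + 1 ≤ eps c * n / L := by
    rw [spent_init]
    linarith
  have hlt : (init n m).spent p + 8 * c * k + Λ < n := by
    have h1 : eps c * n / L ≤ eps c * n :=
      div_le_self (by have := eps_pos hc; positivity) h.one_le
    have := mul_le_mul_of_nonneg_right (eps_lt hc).le hn.le
    linarith
  let S : State n m → Fin n → Bip n m → Prop := fun s v B =>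
    Good p c Λ (s.restart v) (phase p c Λ k (s.restart v) B) ∧
        Linked (phase p c Λ k (s.restart v) B) B
  let g : Fin n → State n m → Bip n m → ℝ := fun v s B =>
    if Good p c Λ (init n m) s ∧ s.mark v = .fresh then (if S s v B then 0 else 1) else 0
  have hpt : ∀ B, (if HasUniqueGiant (interGraph B) t (2 * Λ / (c - 1)) then 0 else 1 : ℝ) ≤
      (if Good p c Λ (init n m) (phase p c Λ k (init n m) B) then 0 else 1) +
        ∑ v, g v (phase p c Λ k (init n m) B) B := by
    intro B
    have hg : ∀ v, 0 ≤ g v (phase p c Λ k (init n m) B) B := fun v => by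
      dsimp only [g]
      split_ifs <;> norm_num
    by_cases hG : Good p c Λ (init n m) (phase p c Λ k (init n m) B)
    · rw [if_pos hG, zero_add]
      split_ifs with hU
      · exact Finset.sum_nonneg fun v _ => hg v
      · by_cases hall : ∀ v, (phase p c Λ k (init n m) B).mark v = .fresh →
            S (phase p c Λ k (init n m) B) v B
        · exact absurd (hasUniqueGiant_of_phases hc hΛ htΛ hlt ht hG
            fun v hv => (hall v hv).2) hU
        · push Not at hall
          obtain ⟨v, hv, hS⟩ := hall
          refine le_trans (le_of_eq ?_) (Finset.single_le_sum (fun v _ => hg v)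
            (Finset.mem_univ v))
          simp [g, hG, hv, hS]
    · rw [if_neg hG]
      have := Finset.sum_nonneg fun v (_ : v ∈ Finset.univ) => hg v
      split_ifs <;> linarith
  refine (integral_mono (integrable_bip p _) (integrable_bip p _) hpt).trans ?_
  rw [integral_add (integrable_bip p _) (integrable_bip p _),
    integral_finsetSum _ fun _ _ => integrable_bip p _]
  refine add_le_add (integral_not_good_phase_le h hs) ?_
  -- Union bound over the vertex `v` from which the second phase starts.
  refine (Finset.sum_le_card_nsmul _ _ (2 * Real.exp (-(rate c / L * Λ)) +
    Real.exp (-(t ^ 2 / (8 * n)))) fun v _ => ?_).trans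
    (by rw [nsmul_eq_mul, Finset.card_univ, Fintype.card_fin])
  -- The second phase and the linking use only pairs unrevealed by the first, so they may be run on
  -- an independent copy.
  have hmarkov := integral_run p (Continues p c Λ k (init n m)) k (init n m) (g v) fun B => by
    intro B₁ B₂ hB
    dsimp only [g]
    by_cases hcond : Good p c Λ (init n m) (run (Continues p c Λ k (init n m)) k (init n m) B) ∧
        (run (Continues p c Λ k (init n m)) k (init n m) B).mark v = .fresh
    · rw [if_pos hcond, if_pos hcond]
      set s := run (Continues p c Λ k (init n m)) k (init n m) B
      have hB' : ∀ e ∈ (s.restart v).unrevealed, B₁ e = B₂ e := fun e he =>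
        hB e (unrevealed_restart_subset hcond.2 he)
      have hrun : phase p c Λ k (s.restart v) B₁ = phase p c Λ k (s.restart v) B₂ :=
        run_dependsOn _ k _ hB'
      have hlink := linked_congr (phase p c Λ k (s.restart v) B₂) fun e he =>
        hB' e (unrevealed_run _ k _ _ he)
      simp only [S, hrun, hlink]
    · rw [if_neg hcond, if_neg hcond]
  unfold phase
  rw [hmarkov]
  refine le_trans (integral_mono (integrable_bip p _) (integrable_bip p fun _ =>
    2 * Real.exp (-(rate c / L * Λ)) + Real.exp (-(t ^ 2 / (8 * n)))) fun B => ?_) (by simp)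
  dsimp only [g]
  by_cases hcond : Good p c Λ (init n m) (run (Continues p c Λ k (init n m)) k (init n m) B) ∧
      (run (Continues p c Λ k (init n m)) k (init n m) B).mark v = .fresh
  · simp only [if_pos hcond]
    have hspent := hcond.1.spent_le hc (card_done_run_le Λ k k (init n m) B)
    rw [spent_init] at hspent
    exact integral_restart_le h hcond.2 (by linarith) hroom
      (ht.trans (le_card_active_phase hc hlt hcond.1)) ht ht0 htL
  · simp only [if_neg hcond, integral_zero]
    positivity

end RandomIntersection

/-! ### Choice of parameters and asymptotics -/

namespace RandomIntersection

open Classical in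
lemma integral_ite_eq_one_sub {n m : ℕ} (p : Fin m → I) (E : Set (Bip n m)) :
    ∫ B, (if B ∈ E then 0 else 1 : ℝ) ∂bipLaw n p = 1 - (bipLaw n p).real E := by
  have h : ∀ B : Bip n m, (if B ∈ E then 0 else 1 : ℝ) = Eᶜ.indicator 1 B := fun B => by
    by_cases hB : B ∈ E <;> simp [hB]
  simp_rw [h]
  rw [integral_indicator_one E.toFinite.measurableSet.compl,
    probReal_compl_eq_one_sub E.toFinite.measurableSet]

/-- The constant in the size of the giant component. -/
noncomputable def giantConst (c : ℝ) : ℝ := (c - 1) / 2 * eps c / (256 * c)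

/-- The constant in the size of the small components. -/
noncomputable def smallConst (c : ℝ) : ℝ := 4 / (rate c * (c - 1))

lemma giantConst_pos {c : ℝ} (hc : 1 < c) : 0 < giantConst c := by
  have := eps_pos hc
  have : 0 < c - 1 := by linarith
  have : 0 < c := by linarith
  unfold giantConst
  positivity

lemma giantConst_le_one {c : ℝ} (hc : 1 < c) : giantConst c ≤ 1 := by
  have := eps_pos hc
  unfold giantConst
  rw [div_le_one (by linarith)]
  nlinarith [eps_lt hc]

lemma smallConst_pos {c : ℝ} (hc : 1 < c) : 0 < smallConst c := by
  have := rate_pos hc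
  have : 0 < c - 1 := by linarith
  unfold smallConst
  positivity

/-- The giant component with explicit error terms, where `ℓ = L * log n` and `x = n / L`. -/
lemma le_measure_hasUniqueGiant {n m : ℕ} {p : Fin m → I} {c L ℓ x : ℝ} (hreg : Regime n p c L)
    (hℓ : ℓ = L * Real.log n) (hx : x = n / L) (hℓ0 : 0 < ℓ)
    (q2 : 16 * ℓ ≤ rate c * eps c * x) (q4 : 64 * c ≤ eps c * x)
    (q5 : 2 * ℓ ≤ rate c * giantConst c * x) (q6 : 2 * smallConst c * ℓ ≤ giantConst c * x)
    (q7 : 16 * ℓ ≤ giantConst c ^ 2 * x) :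
    1 - 5 / (n : ℝ) ≤ (bipLaw n p).real
      {B | HasUniqueGiant (interGraph B) (giantConst c * x) (smallConst c * ℓ)} := by
  have hc := hreg.one_lt
  have hL := hreg.one_le
  have hn := hreg.pos
  have hε := eps_pos hc
  have hr := rate_pos hc
  have hd : 0 < c - 1 := by linarith
  have hc0 : 0 < c := by linarith
  have hL0 : 0 < L := by linarith
  have hx0 : 0 < x := by rw [hx]; positivity
  have ha0 := giantConst_pos hc
  have ha1 := giantConst_le_one hc
  have hC0 := smallConst_pos hc
  have ha : giantConst c = (c - 1) / 2 * eps c / (256 * c) := rfl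
  have hC : smallConst c = 4 / (rate c * (c - 1)) := rfl
  generalize giantConst c = a at ha ha0 ha1 q5 q6 q7 ⊢
  generalize smallConst c = C at hC hC0 q6 ⊢
  generalize hεdef : eps c = ε at ha hε q2 q4
  generalize hrdef : rate c = r at hC hr q2 q5
  -- Chosen so that `exp (-(r / L * Λ)) = n⁻²`, which survives the union bound over `n` vertices.
  obtain ⟨Λ, hΛ⟩ : ∃ Λ, Λ = 2 * ℓ / r := ⟨_, rfl⟩
  have hΛr : r * Λ = 2 * ℓ := by rw [hΛ]; field_simp
  have hΛ0 : 0 ≤ Λ := by rw [hΛ]; positivity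
  obtain ⟨k, hk⟩ : ∃ k, k = ⌊ε * x / (64 * c)⌋₊ := ⟨_, rfl⟩
  have hk1 : 64 * c * k ≤ ε * x := by
    have : (k : ℝ) ≤ ε * x / (64 * c) := hk ▸ Nat.floor_le (by positivity)
    rw [le_div_iff₀ (by positivity)] at this
    linarith
  -- The number under the floor is at least `1`, so rounding loses at most a factor `2`. The `256`
  -- in `giantConst` then gives `2 * a * x ≤ (c - 1) / 2 * k`, one half for the giant and the other
  -- for `Λ`.
  have hk2 : ε * x ≤ 128 * c * k := by
    have h1 : 1 ≤ k := hk ▸ Nat.le_floor (by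
      rw [Nat.cast_one, le_div_iff₀ (by positivity)]
      linarith)
    have h1 : (1 : ℝ) ≤ k := by exact_mod_cast h1
    have h2 : ε * x / (64 * c) < k + 1 := hk ▸ Nat.lt_floor_add_one _
    rw [div_lt_iff₀ (by positivity)] at h2
    nlinarith
  have hCΛ : 2 * Λ / (c - 1) = C * ℓ := by
    rw [hΛ, hC]
    field_simp
    ring
  have hΛε : 8 * Λ ≤ ε * x := by
    refine le_of_mul_le_mul_left ?_ hr
    linarith
  have hΛa : Λ ≤ a * x := by
    refine le_of_mul_le_mul_left ?_ hr
    linarith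
  have hkey := integral_not_hasUniqueGiant_le (k := k) (t := a * x) hreg hΛ0
    (by rw [mul_div_assoc, ← hx, hεdef]; linarith) (by
      have : a * x * 256 * c = (c - 1) / 2 * (ε * x) := by
        rw [ha]
        field_simp
      have h2 : (c - 1) / 2 * (ε * x) ≤ (c - 1) / 2 * (128 * c * k) := by gcongr
      have h3 : c * (2 * (a * x)) ≤ c * ((c - 1) / 2 * k) := by linarith
      have := le_of_mul_le_mul_left h3 hc0
      linarith) (by
      rw [hCΛ]
      have : 0 < C * ℓ := by positivity
      linarith) (by rw [← hx]; nlinarith)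
  rw [hCΛ] at hkey
  have hset := integral_ite_eq_one_sub p
    {B : Bip n m | HasUniqueGiant (interGraph B) (a * x) (C * ℓ)}
  simp only [Set.mem_ofPred_eq] at hset
  rw [hset] at hkey
  have hexp : Real.exp (-(2 * Real.log n)) = 1 / (n : ℝ) ^ 2 := by
    rw [Real.exp_neg, mul_comm, Real.exp_mul, Real.exp_log hn, Real.rpow_two, one_div]
  have e1 : Real.exp (-(rate c / L * Λ)) = 1 / (n : ℝ) ^ 2 := by
    rw [← hexp]
    congr 2
    calc rate c / L * Λ = r * Λ / L := by rw [hrdef]; ring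
      _ = 2 * Real.log n := by
        rw [hΛr, hℓ]
        field_simp
  -- This needs `x ^ 2` to exceed a multiple of `n * log n`, that is, `L ^ 2 * log n` to be small
  -- against `n`.
  have e2 : Real.exp (-((a * x) ^ 2 / (8 * n))) ≤ 1 / (n : ℝ) ^ 2 := by
    rw [← hexp, Real.exp_le_exp, neg_le_neg_iff, le_div_iff₀ (by positivity)]
    have h1 : x * L = n := by rw [hx]; field_simp
    calc 2 * Real.log n * (8 * n) = x * (16 * ℓ) := by rw [hℓ, ← h1]; ring
      _ ≤ x * (a ^ 2 * x) := by gcongr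
      _ = (a * x) ^ 2 := by ring
  rw [e1] at hkey
  have h1n : (1 : ℝ) ≤ n := by
    have : 0 < n := by exact_mod_cast hn
    exact_mod_cast this
  have e3 : 1 / (n : ℝ) ^ 2 ≤ 1 / n := by
    rw [div_le_div_iff₀ (by positivity) hn]
    nlinarith
  have e4 : n * (1 / (n : ℝ) ^ 2) = 1 / n := by field_simp
  have e5 : n * (2 * (1 / (n : ℝ) ^ 2) + Real.exp (-((a * x) ^ 2 / (8 * n)))) ≤ 3 * (1 / n) := by
    calc _ ≤ n * (2 * (1 / (n : ℝ) ^ 2) + 1 / (n : ℝ) ^ 2) := by gcongr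
      _ = 3 * (n * (1 / (n : ℝ) ^ 2)) := by ring
      _ = _ := by rw [e4]
  have : 5 / (n : ℝ) = 5 * (1 / n) := by ring
  linarith

/-- The giant component with explicit error terms, when `L ^ 2 * log n` is much smaller
than `n`. -/
lemma exists_le_measure_hasUniqueGiant {c : ℝ} (hc : 1 < c) :
    ∃ a > (0 : ℝ), ∃ C > (0 : ℝ), ∃ K > (0 : ℝ), ∀ (n m : ℕ) (p : Fin m → I) (L : ℝ),
      3 ≤ n → 1 ≤ L → (∀ i, n * (p i : ℝ) ≤ L) → n * ∑ i, (p i : ℝ) ^ 2 = c →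
      K * (L * Real.log n) ≤ n / L →
      1 - 5 / (n : ℝ) ≤ (bipLaw n p).real
        {B | HasUniqueGiant (interGraph B) (a * (n / L)) (C * (L * Real.log n))} := by
  have hε := eps_pos hc
  have hr := rate_pos hc
  have hc0 : 0 < c := by linarith
  have ha0 := giantConst_pos hc
  have hC0 := smallConst_pos hc
  have p1 : 0 < 1 / rate c := by positivity
  have p2 : 0 < 16 / (rate c * eps c) := by positivity
  have p4 : 0 < 64 * c / eps c := by positivity
  have p5 : 0 < 2 / (rate c * giantConst c) := by positivity
  have p6 : 0 < 2 * smallConst c / giantConst c := by positivity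
  have p7 : 0 < 16 / giantConst c ^ 2 := by positivity
  -- Each summand is the ratio required by one hypothesis of `le_measure_hasUniqueGiant`, and being
  -- positive they are all at most `K`.
  obtain ⟨K, hKdef⟩ : ∃ K, K = 1 / rate c + 16 / (rate c * eps c) + 64 * c / eps c +
    2 / (rate c * giantConst c) + 2 * smallConst c / giantConst c + 16 / giantConst c ^ 2 :=
    ⟨_, rfl⟩
  refine ⟨giantConst c, ha0, smallConst c, hC0, K, by linarith,
    fun n m p L hn3 hL hp hsum hK => ?_⟩
  have hn : (0 : ℝ) < n := by positivity
  have hL0 : 0 < L := by linarith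
  have hlog : 1 ≤ Real.log n := by
    rw [Real.le_log_iff_exp_le hn]
    have : (3 : ℝ) ≤ n := by exact_mod_cast hn3
    linarith [Real.exp_one_lt_d9]
  have hℓ1 : 1 ≤ L * Real.log n := by nlinarith
  have hx0 : 0 < n / L := by positivity
  have hbound : ∀ u v, 0 < v → u / v ≤ K → u * (L * Real.log n) ≤ v * (n / L) := by
    intro u v hv h
    have := (mul_le_mul_of_nonneg_right h (by linarith)).trans hK
    rw [div_mul_eq_mul_div, div_le_iff₀ hv] at this
    linarith
  have q1 := hbound 1 _ hr (by linarith)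
  have q4 := hbound (64 * c) _ hε (by linarith)
  refine le_measure_hasUniqueGiant ⟨hc, hL, hn, hp, hsum, ?_⟩ rfl rfl (by linarith)
    (hbound _ _ (by positivity) (by linarith)) ?_
    (hbound _ _ (by positivity) (by linarith)) (hbound _ _ (by positivity) (by linarith))
    (hbound _ _ (by positivity) (by linarith))
  · rw [← one_div_div, div_le_iff₀ hx0]
    linarith
  · have := mul_le_mul_of_nonneg_left hℓ1 (by positivity : 0 ≤ 64 * c)
    linarith

/-- Lowering the threshold creates no second giant while it stays above `t`. -/
lemma HasUniqueGiant.mono {V : Type*} {G : SimpleGraph V} {s s' t : ℝ}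
    (h : HasUniqueGiant G s t) (hs : s' ≤ s) (ht : t < s') : HasUniqueGiant G s' t := by
  obtain ⟨K, hK, h⟩ := h
  exact ⟨K, hs.trans hK, fun K' hK' => ⟨(h K' hK').2.trans_lt ht, (h K' hK').2⟩⟩

lemma WHP.mono {m : ℕ → ℕ} {p : ∀ n, Fin (m n) → I} {E E' : ∀ n, SimpleGraph (Fin n) → Prop}
    (h : WHP p E) (hE : ∀ᶠ n in atTop, ∀ G, E n G → E' n G) : WHP p E' := by
  refine tendsto_of_tendsto_of_tendsto_of_le_of_le' h tendsto_const_nhds ?_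
    (.of_forall fun n => prob_le_one)
  filter_upwards [hE] with n hn
  exact measure_mono fun B hB => hn _ hB

lemma whp_of_le {m : ℕ → ℕ} {p : ∀ n, Fin (m n) → I} {E : ∀ n, SimpleGraph (Fin n) → Prop}
    (h : ∀ᶠ n : ℕ in atTop, 1 - 5 / (n : ℝ) ≤ (bipLaw n (p n)).real {B | E n (interGraph B)}) :
    WHP p E := by
  have hlim : Tendsto (fun n : ℕ => ENNReal.ofReal (1 - 5 / (n : ℝ))) atTop (𝓝 1) := by
    rw [← ENNReal.ofReal_one]
    refine (ENNReal.continuous_ofReal.tendsto _).comp ?_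
    simpa using (tendsto_const_nhds (x := (1 : ℝ))).sub (tendsto_const_div_atTop_nhds_zero_nat 5)
  refine tendsto_of_tendsto_of_tendsto_of_le_of_le' hlim tendsto_const_nhds ?_
    (.of_forall fun n => prob_le_one)
  filter_upwards [h] with n hn
  exact ENNReal.ofReal_le_of_le_toReal hn

lemma le_maxProb {m : ℕ} (p : Fin m → I) (i : Fin m) : (p i : ℝ) ≤ maxProb p :=
  le_ciSup (f := fun i => (p i : ℝ)) (Set.finite_range _).bddAbove i

/-- If `q n = o(n ^ (-γ))` with `γ > 1 / 2` then `max (n * q n) 1 ^ 2 * log n` is small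
compared with `n`. -/
lemma eventually_mul_log_le {q : ℕ → ℝ} {γ : ℝ} (hγ : 1 / 2 < γ)
    (hq : q =o[atTop] fun n : ℕ => (n : ℝ) ^ (-γ)) {K : ℝ} (hK : 0 < K) :
    ∀ᶠ n : ℕ in atTop, K * (max (n * q n) 1 * Real.log n) ≤ n / max (n * q n) 1 := by
  -- With `β` this maximum, `max (n * q n) 1 ≤ n ^ β`, and `2 * β < 1` leaves a positive power of
  -- `n` to absorb the logarithm.
  have hβ : max (1 - γ) 0 < 1 / 2 := max_lt (by linarith) (by norm_num)
  set β := max (1 - γ) 0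
  have hlog := (isLittleO_log_rpow_atTop (r := 1 - 2 * β) (by linarith)).comp_tendsto
    tendsto_natCast_atTop_atTop
  filter_upwards [hq.bound one_pos, hlog.bound (inv_pos.2 hK), eventually_ge_atTop 1] with
    n h1 h2 h3
  have hn : (1 : ℝ) ≤ n := by exact_mod_cast h3
  have hn0 : (0 : ℝ) < n := by linarith
  have hL : max (n * q n) 1 ≤ (n : ℝ) ^ β := by
    refine max_le ?_ (Real.one_le_rpow hn (le_max_right _ _))
    rw [one_mul, Real.norm_of_nonneg (by positivity : 0 ≤ (n : ℝ) ^ (-γ))] at h1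
    calc n * q n ≤ n * (n : ℝ) ^ (-γ) := by gcongr; exact (le_abs_self _).trans h1
      _ = (n : ℝ) ^ (1 - γ) := by
        rw [sub_eq_add_neg, Real.rpow_add hn0, Real.rpow_one]
      _ ≤ _ := Real.rpow_le_rpow_of_exponent_le hn (le_max_left _ _)
  have hlog0 : 0 ≤ Real.log n := Real.log_nonneg hn
  simp only [Function.comp_apply] at h2
  rw [Real.norm_of_nonneg hlog0, Real.norm_of_nonneg (by positivity), inv_mul_eq_div,
    le_div_iff₀ hK] at h2
  have hL1 : 1 ≤ max (n * q n) 1 := le_max_right _ _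
  rw [le_div_iff₀ (by linarith)]
  calc K * (max (n * q n) 1 * Real.log n) * max (n * q n) 1
      = (max (n * q n) 1 * max (n * q n) 1) * (Real.log n * K) := by ring
    _ ≤ ((n : ℝ) ^ β * (n : ℝ) ^ β) * (n : ℝ) ^ (1 - 2 * β) := by gcongr
    _ = n := by
      rw [← Real.rpow_add hn0, ← Real.rpow_add hn0]
      ring_nf
      exact Real.rpow_one _

lemma min_inv_eq_div_max {x q : ℝ} (hx : 0 < x) (hq : 0 < q) : min q⁻¹ x = x / max (x * q) 1 := by
  rcases le_total (x * q) 1 with h | h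
  · rw [max_eq_right h, div_one, min_eq_right]
    rw [inv_eq_one_div, le_div_iff₀ hq]
    exact h
  · rw [max_eq_left h, min_eq_left]
    · field_simp
    · rw [inv_eq_one_div, div_le_iff₀ hq]
      exact h

end RandomIntersection

theorem mainTheorem3 (c : ℝ) (hc : 1 < c) :
    ∃ a > (0 : ℝ), ∃ C > (0 : ℝ),
      ∀ (m : ℕ → ℕ) (p : ∀ n, Fin (m n) → unitInterval) (γ : ℝ),
        1 / 2 < γ →
        (∀ᶠ n : ℕ in atTop, (n : ℝ) * ∑ i, (p n i : ℝ) ^ 2 = c) →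
        (fun n => RandomIntersection.maxProb (p n)) =o[atTop] (fun n : ℕ => (n : ℝ) ^ (-γ)) →
        RandomIntersection.WHP p (fun n G => RandomIntersection.HasUniqueGiant G
            (a * min (RandomIntersection.maxProb (p n))⁻¹ (n : ℝ))
            (C * max (n * RandomIntersection.maxProb (p n) * Real.log n) (Real.log n))) ∧
        ((fun n => (RandomIntersection.maxProb (p n))⁻¹) =o[atTop] (fun n : ℕ => (n : ℝ)) →
          RandomIntersection.WHP p (fun n G => RandomIntersection.HasUniqueGiant G
            (a * (RandomIntersection.maxProb (p n))⁻¹)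
            (C * max (n * RandomIntersection.maxProb (p n) * Real.log n) (Real.log n)))) ∧
        ((fun n : ℕ => (n : ℝ)) =O[atTop] (fun n => (RandomIntersection.maxProb (p n))⁻¹) →
          ∃ b > (0 : ℝ), RandomIntersection.WHP p (fun n G => RandomIntersection.HasUniqueGiant G
            (b * n)
            (C * max (n * RandomIntersection.maxProb (p n) * Real.log n) (Real.log n)))) := by
  open RandomIntersection in
  obtain ⟨a, ha, C, hC, K, hK, hcore⟩ := exists_le_measure_hasUniqueGiant hc
  refine ⟨a, ha, C, hC, fun m p γ hγ hsum hmax => ?_⟩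
  -- Otherwise every `p i` vanishes and the sum is `0`, not `c`. This also excludes the empty
  -- supremum and the default value `0⁻¹ = 0`.
  have hpos : ∀ᶠ n : ℕ in atTop, 0 < maxProb (p n) := by
    filter_upwards [hsum] with n hn
    by_contra hle
    have h0 : ∀ i, (p n i : ℝ) = 0 := fun i =>
      le_antisymm ((le_maxProb (p n) i).trans (not_lt.1 hle)) (p n i).2.1
    simp only [h0] at hn
    norm_num at hn
    linarith
  have hlogmax : ∀ n : ℕ, 1 ≤ n →
      max (n * maxProb (p n) * Real.log n) (Real.log n) =
        max (n * maxProb (p n)) 1 * Real.log n := fun n hn => by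
    have : 0 ≤ Real.log n := Real.log_nonneg (by exact_mod_cast hn)
    rw [max_mul_of_nonneg _ _ this, one_mul]
  have hmain : WHP p (fun n G => HasUniqueGiant G (a * min (maxProb (p n))⁻¹ (n : ℝ))
      (C * max (n * maxProb (p n) * Real.log n) (Real.log n))) := by
    refine whp_of_le ?_
    filter_upwards [hsum, hpos, eventually_mul_log_le hγ hmax hK, eventually_ge_atTop 3] with
      n h1 h2 h3 h4
    rw [hlogmax n (by omega), min_inv_eq_div_max (by positivity) h2]
    exact hcore n (m n) (p n) _ h4 (le_max_right _ _)
      (fun i => le_max_of_le_left (by gcongr; exact le_maxProb (p n) i)) h1 h3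
  refine ⟨hmain, fun hlittle => hmain.mono ?_, fun hbig => ?_⟩
  · filter_upwards [hlittle.bound one_pos] with n hn G hG
    rw [one_mul, Real.norm_natCast] at hn
    rwa [min_eq_left ((le_abs_self _).trans hn)] at hG
  · obtain ⟨D, hD, hbound⟩ := hbig.exists_pos
    have hb : 0 < a * min 1 D⁻¹ := by positivity
    -- From `n ≤ D * p⁻¹` one gets `min p⁻¹ n ≥ min 1 D⁻¹ * n`.
    refine ⟨a * min 1 D⁻¹, hb, hmain.mono ?_⟩
    filter_upwards [hpos, hbound.bound,
      -- The factor `2` makes the bound on the small components strictly less than `b * n`, as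
      -- `HasUniqueGiant.mono` requires.
      eventually_mul_log_le hγ hmax (K := 2 * C / (a * min 1 D⁻¹)) (by positivity),
      eventually_ge_atTop 1] with n h1 h2 h3 h4 G hG
    have hn : (0 : ℝ) < n := by positivity
    refine hG.mono ?_ ?_
    · rw [mul_assoc]
      gcongr
      rw [Real.norm_natCast, Real.norm_of_nonneg (inv_pos.2 h1).le] at h2
      refine le_min ?_ ?_
      · calc min 1 D⁻¹ * n ≤ D⁻¹ * n := by gcongr; exact min_le_right _ _
          _ ≤ _ := by rw [inv_mul_le_iff₀ hD]; exact h2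
      · calc min 1 D⁻¹ * n ≤ 1 * n := by gcongr; exact min_le_left _ _
          _ = n := one_mul _
    · rw [hlogmax n h4]
      have hle : n / max (n * maxProb (p n)) 1 ≤ (n : ℝ) := div_le_self hn.le (le_max_right _ _)
      have h5 := h3.trans hle
      rw [div_mul_eq_mul_div, div_le_iff₀ hb] at h5
      have : 0 < (a * min 1 D⁻¹) * n := by positivity
      linarith
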